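/- Topological manifolds are second countable, Hausdorff, without boundary, and of some finite dimension. **The category $\mathbf{Map}$.** Objects are pairs $(f,X)$ with $X$ a topological manifold and $f:X\to X$ a homeomorphism; a morphism $(f,X)\to(g,Y)$ is a continuous map $h:X\to Y$ with $h\circ f=g\circ h$. **Flows and sections.** A flow $(\Phi,X)$ is a continuous action $\Phi:X\times\mathbb R\to X$ of $(\mathbb R,+)$ on a topological manifold $X$. A subset $S\subset X$, with $\dim X=n\ge 1$, is *topologically transversal* to $\Phi$ if 1. $S$ is a locally flat submanifold of codimension one without boundary; 2. there are functions $\delta_+>0$ and $\delta_-<0$ on $S$ such that every $x\in S$ has an open neighbourhood $U$ and a homeomorphism $\phi$ from $U$ onto the open unit ball $B\subset\mathbb R^n$ with $\phi(U\cap S)=B\cap(\mathbb R^{n-1}\times\{0\})$, for which $\Phi(x,[\delta_-(x),0))$ and $\Phi(x,(0,\delta_+(x)])$ lie in different connected components of $U\setminus S$ and $\Phi(x,[\delta_-(x),\delta_+(x)])\cap S=\{x\}$; moreover there are a neighbourhood $V\subset U$ of $x$ and $\delta>0$ with $\delta_+(y)>\delta$ and $\delta_-(y)<-\delta$ for all $y\in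 V\cap S$; 3. $\Phi(y,[a,b])\cap S$ is compact for all $y\in X$ and $a,b\in\mathbb R$. $S$ is a *global Poincaré section* if it is a closed subset of $X$, is topologically transversal to $\Phi$, and for every $x\in X$ there are $t_+>0$ and $t_-<0$ with $\Phi(x,t_\pm)\in S$. For $x\in S$ put $T_\Phi(x)=\min\{t>0:\Phi(x,t)\in S\}$, $P\Phi(x)=\Phi(x,T_\Phi(x))$, and $R_\Phi(x)(u)=\sum_{i\in\mathbb Z}T_\Phi((P\Phi)^i(x))\,\chi_{[i,i+1)}(u)$ (the map $P\Phi:S\to S$ is a bijection). **The category $\mathbf{RWFlowGS}$.** Objects are triples $(\Phi,X,S)$ with $S$ a global Poincaré section of the flow $(\Phi,X)$. A morphism $(\Phi_1,X_1,S_1)\to(\Phi_2,X_2,S_2)$ is a pair $(h,\sigma)$ of a continuous map $h:X_1\to X_2$ and a map $\sigma:X_1\times\mathbb R\to\mathbb R$ such that each $\sigma(x,-)$ is an increasing homeomorphism of $\mathbb R$ with $\sigma(x,0)=0$, $h(\Phi_1(x,t))=\Phi_2(h(x),\sigma(x,t))$ for all $x,t$, $S_1=h^{-1}(S_2)$, and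 (rate preservation) $$\sigma\Bigl(\Phi_1(x,tT_{\Phi_1}(x)),\int_0^{s+t}R_{\Phi_1}(x)(u)\,du-tT_{\Phi_1}(x)\Bigr)=\int_0^{s+t}R_{\Phi_2}(h(x))(u)\,du-tT_{\Phi_2}(h(x))$$ for all $x\in S_1$, $0\le t<1$, $s\in\mathbb R$. Composition is $(h_2,\sigma_2)\circ(h_1,\sigma_1)=(h_2\circ h_1,\ (x,t)\mapsto\sigma_2(h_1(x),\sigma_1(x,t)))$. **The functors.** For $(f,X)$ in $\mathbf{Map}$ let $X_f$ be the quotient of $X\times[0,1]$ by the equivalence relation generated by $(x,1)\sim(f(x),0)$, let $\Sigma f([x,t],s)=[f^n(x),s+t-n]$ with $n=\lfloor s+t\rfloor$ (for $0\le t<1$), and let $(X_f)_0=\{[x,0]:x\in X\}$. Let $\Sigma$ send $(f,X)$ to $(\Sigma f,X_f,(X_f)_0)$ and $h$ to $([x,t]\mapsto[h(x),t],\ \mathrm{id})$, and let $P$ send $(\Phi,X,S)$ to $(P\Phi,S)$ and $(h,\sigma)$ to $h|_{S_1}:S_1\to S_2$. **Corollary.** The categories $\mathbf{Map}$ and $\mathbf{RWFlowGS}$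 are equivalent. More precisely, $\Sigma:\mathbf{Map}\to\mathbf{RWFlowGS}$ and $P:\mathbf{RWFlowGS}\to\mathbf{Map}$ are well-defined functors (in particular $X_f$ and $S$ are topological manifolds, $\Sigma f$ is continuous, $(X_f)_0$ is a global Poincaré section and $P\Phi$ is a homeomorphism), and there is an adjunction $\Sigma\dashv P$ with unit $l_{(f,X)}(x)=[x,0]$ and counit $(k,\tau)_{(\Phi,X,S)}$ given, for $x\in S$, $0\le t<1$, $s\in\mathbb R$, by $$k([x,t])=\Phi(x,tT_\Phi(x)),\qquad \tau([x,t],s)=\int_0^{s+t}R_\Phi(x)(u)\,du-tT_\Phi(x),$$ whose unit and counit are both natural isomorphisms. -/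

import Mathlib

open CategoryTheory Topology

universe u

/-! ### Topological manifolds (second countable, Hausdorff, without boundary) -/

/-- `X` is a topological manifold of dimension `n`, without boundary: Hausdorff, second countable,
and locally homeomorphic to `ℝⁿ`. -/
def IsTopManifoldOfDim (n : ℕ) (X : Type u) [TopologicalSpace X] : Prop :=
  T2Space X ∧ SecondCountableTopology X ∧ Nonempty (ChartedSpace (EuclideanSpace ℝ (Fin n)) X)

/-- `X` is a topological manifold of some dimension. -/
def IsTopManifold (X : Type u) [TopologicalSpace X] : Prop :=
  ∃ n : ℕ, IsTopManifoldOfDim n X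

/-! ### The category of map dynamical systems -/

/-- A map dynamical system: a self-homeomorphism of a topological manifold. -/
structure MapDS : Type (u + 1) where
  carrier : Type u
  [top : TopologicalSpace carrier]
  manifold : IsTopManifold carrier
  map : carrier ≃ₜ carrier

attribute [instance] MapDS.top

/-- A morphism of map dynamical systems: a continuous map commuting with the homeomorphisms. -/
@[ext]
structure MapDS.Hom (M N : MapDS.{u}) where
  toFun : M.carrier → N.carrier
  continuous_toFun : Continuous toFun
  comm : ∀ x, toFun (M.map x) = N.map (toFun x)

instance MapDS.category : Category MapDS.{u} where
  Hom M N := MapDS.Hom M N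
  id _ := ⟨id, continuous_id, fun _ => rfl⟩
  comp f g := ⟨g.toFun ∘ f.toFun, g.continuous_toFun.comp f.continuous_toFun, fun x => by
    simp [f.comm, g.comm]⟩

/-! ### Transversality and global Poincaré sections -/

section Sections

variable {X : Type u} [TopologicalSpace X]

/-- `S` is a locally flat submanifold (without boundary) of codimension one of the
`(m + 1)`-dimensional manifold `X`: around each point of `S` there is a chart of `X` in which `S`
is the hyperplane where the last coordinate vanishes. -/
def IsLocallyFlatHypersurface (m : ℕ) (S : Set X) : Prop :=
  ∀ x ∈ S, ∃ φ : OpenPartialHomeomorph X (EuclideanSpace ℝ (Fin (m + 1))),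
    x ∈ φ.source ∧ ∀ y ∈ φ.source, y ∈ S ↔ φ y (Fin.last m) = 0

/-- Topological transversality of `S` to the flow `Φ` (Mathlib's `Flow`: `Φ t x` is the point
reached from `x` at time `t`). The numbers `δp x > 0` and `δm x < 0` are the times `δ₊(x)`, `δ₋(x)`
for which the two arcs issuing from `x ∈ S` lie in different connected components of `U \ S`. -/
def IsTopTransversal (Φ : Flow ℝ X) (S : Set X) : Prop :=
  ∃ m : ℕ, IsTopManifoldOfDim (m + 1) X ∧
    IsLocallyFlatHypersurface m S ∧
    (∃ δp δm : X → ℝ, ∀ x ∈ S, 0 < δp x ∧ δm x < 0 ∧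
      ∃ φ : OpenPartialHomeomorph X (EuclideanSpace ℝ (Fin (m + 1))),
        x ∈ φ.source ∧ φ.target = Metric.ball 0 1 ∧
        (∀ y ∈ φ.source, y ∈ S ↔ φ y (Fin.last m) = 0) ∧
        (∃ a ∈ φ.source \ S, ∃ b ∈ φ.source \ S,
          connectedComponentIn (φ.source \ S) a ≠ connectedComponentIn (φ.source \ S) b ∧
          (∀ t ∈ Set.Ico (δm x) 0, Φ t x ∈ connectedComponentIn (φ.source \ S) a) ∧
          (∀ t ∈ Set.Ioc 0 (δp x), Φ t x ∈ connectedComponentIn (φ.source \ S) b)) ∧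
        ((fun t => Φ t x) '' Set.Icc (δm x) (δp x)) ∩ S = {x} ∧
        (∃ V ∈ 𝓝 x, V ⊆ φ.source ∧ ∃ δ > 0, ∀ y ∈ V ∩ S, δ < δp y ∧ δm y < -δ)) ∧
    ∀ (y : X) (a b : ℝ), IsCompact (((fun t => Φ t y) '' Set.Icc a b) ∩ S)

/-- `S` is a global Poincaré section of `Φ`: a closed subset, topologically transversal to `Φ`, to
which every orbit returns in positive and in negative time. -/
structure IsGlobalPoincareSection (Φ : Flow ℝ X) (S : Set X) : Prop where
  isClosed : IsClosed S
  transversal : IsTopTransversal Φ S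
  forward : ∀ x, ∃ t : ℝ, 0 < t ∧ Φ t x ∈ S
  backward : ∀ x, ∃ t : ℝ, t < 0 ∧ Φ t x ∈ S

/-- The first return time `T_Φ(x)` to `S`. -/
noncomputable def returnTime (Φ : Flow ℝ X) (S : Set X) (x : X) : ℝ :=
  sInf {t : ℝ | 0 < t ∧ Φ t x ∈ S}

variable {Φ : Flow ℝ X} {S : Set X}

theorem IsGlobalPoincareSection.gap (h : IsGlobalPoincareSection Φ S) {x : X} (hx : x ∈ S) :
    ∃ δ > 0, ∀ t : ℝ, 0 < |t| → |t| ≤ δ → Φ t x ∉ S := by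
  obtain ⟨m, -, -, ⟨δp, δm, H⟩, -⟩ := h.transversal
  obtain ⟨hp, hm, φ, -, -, -, ⟨a, -, b, -, -, ha, hb⟩, -, -⟩ := H x hx
  refine ⟨min (δp x) (-δm x), lt_min hp (by linarith), fun t ht0 ht => ?_⟩
  have h1 := ht.trans (min_le_left _ _)
  have h2 := ht.trans (min_le_right _ _)
  rcases lt_or_gt_of_ne (abs_pos.mp ht0) with h0 | h0
  · rw [abs_of_neg h0] at h2
    exact (connectedComponentIn_subset _ _ (ha t ⟨by linarith, h0⟩)).2
  · rw [abs_of_pos h0] at h1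
    exact (connectedComponentIn_subset _ _ (hb t ⟨h0, h1⟩)).2

theorem exists_isLeast_hits (hS : IsClosed S) {γ : ℝ → X} (hγ : Continuous γ)
    {δ : ℝ} (hδ : 0 < δ) (hgap : ∀ t, 0 < t → t ≤ δ → γ t ∉ S) (hne : ∃ t, 0 < t ∧ γ t ∈ S) :
    IsLeast {t : ℝ | 0 < t ∧ γ t ∈ S} (sInf {t : ℝ | 0 < t ∧ γ t ∈ S}) := by
  have he : {t : ℝ | 0 < t ∧ γ t ∈ S} = Set.Ici δ ∩ γ ⁻¹' S := by
    ext t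
    constructor
    · rintro ⟨h1, h2⟩
      exact ⟨le_of_not_ge fun h => hgap t h1 h h2, h2⟩
    · rintro ⟨h1, h2⟩
      exact ⟨hδ.trans_le h1, h2⟩
  have hb : BddBelow {t : ℝ | 0 < t ∧ γ t ∈ S} := ⟨0, fun t ht => ht.1.le⟩
  have hc : IsClosed {t : ℝ | 0 < t ∧ γ t ∈ S} := by
    rw [he]
    exact isClosed_Ici.inter (hS.preimage hγ)
  exact ⟨hc.csInf_mem hne hb, fun t ht => csInf_le hb ht⟩

theorem IsGlobalPoincareSection.isLeast_returnTime (h : IsGlobalPoincareSection Φ S) {x : X}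
    (hx : x ∈ S) : IsLeast {t : ℝ | 0 < t ∧ Φ t x ∈ S} (returnTime Φ S x) := by
  obtain ⟨δ, hδ, hg⟩ := h.gap hx
  exact exists_isLeast_hits h.isClosed (Φ.continuous continuous_id continuous_const) hδ
    (fun t h0 h1 => hg t (by rwa [abs_of_pos h0]) (by rwa [abs_of_pos h0])) (h.forward x)

/-- The Poincaré (first return) map `x ↦ Φ(x, T_Φ(x))` of a global Poincaré section. -/
noncomputable def poincareFun (h : IsGlobalPoincareSection Φ S) (x : S) : S :=
  ⟨Φ (returnTime Φ S x) x, (h.isLeast_returnTime x.2).1.2⟩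

theorem poincareFun_bijective (h : IsGlobalPoincareSection Φ S) :
    Function.Bijective (poincareFun h) := by
  constructor
  · have key : ∀ x y : S, poincareFun h x = poincareFun h y →
        returnTime Φ S x ≤ returnTime Φ S y → x = y := by
      intro x y hxy hle
      have e : Φ (returnTime Φ S y - returnTime Φ S x) y = (x : X) := by
        have e1 : Φ (returnTime Φ S x) x = Φ (returnTime Φ S y) y := congrArg Subtype.val hxy
        rw [sub_eq_neg_add, Φ.map_add, ← e1, ← Φ.map_add, neg_add_cancel, Φ.map_zero_apply]
      rcases hle.eq_or_lt with heq | hlt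
      · rw [heq, sub_self, Φ.map_zero_apply] at e
        exact Subtype.ext e.symm
      · have h1 := (h.isLeast_returnTime y.2).2
          (show _ ∈ {t : ℝ | 0 < t ∧ Φ t y ∈ S} from ⟨sub_pos.2 hlt, by rw [e]; exact x.2⟩)
        have h2 := (h.isLeast_returnTime x.2).1.1
        linarith
    intro x y hxy
    rcases le_total (returnTime Φ S x) (returnTime Φ S y) with hle | hle
    · exact key x y hxy hle
    · exact (key y x hxy.symm hle).symm
  · intro y
    obtain ⟨δ, hδ, hg⟩ := h.gap y.2
    have hl := exists_isLeast_hits h.isClosed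
      (γ := fun t => Φ (-t) y) (Φ.continuous continuous_neg continuous_const) hδ
      (fun t h0 h1 => hg (-t) (by rwa [abs_neg, abs_of_pos h0])
        (by rwa [abs_neg, abs_of_pos h0]))
      (by
        obtain ⟨t, ht, hty⟩ := h.backward y
        exact ⟨-t, by linarith, by simpa using hty⟩)
    set r := sInf {t : ℝ | 0 < t ∧ Φ (-t) y ∈ S} with hr
    have hT := h.isLeast_returnTime hl.1.2
    have hTr : returnTime Φ S (Φ (-r) y) ≤ r :=
      hT.2 ⟨hl.1.1, by rw [← Φ.map_add, add_neg_cancel, Φ.map_zero_apply]; exact y.2⟩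
    have hrT : r ≤ returnTime Φ S (Φ (-r) y) := by
      by_contra hlt
      push Not at hlt
      have h1 := hl.2 (show r - returnTime Φ S (Φ (-r) y) ∈ {t : ℝ | 0 < t ∧ Φ (-t) y ∈ S} from
        ⟨sub_pos.2 hlt, by
          have := hT.1.2
          rwa [← Φ.map_add, ← sub_eq_add_neg, ← neg_sub] at this⟩)
      linarith [hT.1.1]
    refine ⟨⟨Φ (-r) y, hl.1.2⟩, Subtype.ext ?_⟩
    change Φ (returnTime Φ S (Φ (-r) y)) (Φ (-r) y) = y
    rw [le_antisymm hTr hrT, ← Φ.map_add, add_neg_cancel, Φ.map_zero_apply]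

/-- The Poincaré map `PΦ` as a bijection of `S`, so that it has integer iterates. -/
noncomputable def poincareMap (h : IsGlobalPoincareSection Φ S) : Equiv.Perm S :=
  Equiv.ofBijective (poincareFun h) (poincareFun_bijective h)

/-- The function `R_Φ(x)(u) = ∑ i ∈ ℤ, T_Φ((PΦ)^i x) · χ_[i,i+1)(u)`. -/
noncomputable def returnRate (h : IsGlobalPoincareSection Φ S) (x : S) (u : ℝ) : ℝ :=
  ∑' i : ℤ, returnTime Φ S ((poincareMap h ^ i) x : S) *
    Set.indicator (Set.Ico (i : ℝ) (i + 1)) 1 u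

/-- The time change `∫ u in 0..s+t, R_Φ(x)(u) - t T_Φ(x)`. -/
noncomputable def rateTime (h : IsGlobalPoincareSection Φ S) (x : S) (t s : ℝ) : ℝ :=
  (∫ u in (0 : ℝ)..(s + t), returnRate h x u) - t * returnTime Φ S x

theorem returnRate_of_mem (h : IsGlobalPoincareSection Φ S) (x : S) {u : ℝ}
    (hu : u ∈ Set.Ico (0 : ℝ) 1) : returnRate h x u = returnTime Φ S x := by
  unfold returnRate
  rw [tsum_eq_single 0]
  · simp [hu.1, hu.2]
  · intro i hi
    rw [Set.indicator_of_notMem, mul_zero]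
    rintro ⟨h1, h2⟩
    apply hi
    have h3 : (i : ℝ) < 1 := h1.trans_lt hu.2
    have h4 : (0 : ℝ) < i + 1 := hu.1.trans_lt h2
    norm_cast at h3 h4
    omega

theorem rateTime_zero (h : IsGlobalPoincareSection Φ S) (x : S) {t : ℝ}
    (ht : t ∈ Set.Ico (0 : ℝ) 1) : rateTime h x 0 t = t * returnTime Φ S x := by
  have : (∫ u in (0 : ℝ)..(t + 0), returnRate h x u) =
      ∫ _ in (0 : ℝ)..(t + 0), returnTime Φ S x := by
    apply intervalIntegral.integral_congr
    intro u hu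
    rw [add_zero, Set.uIcc_of_le ht.1] at hu
    exact returnRate_of_mem h x ⟨hu.1, hu.2.trans_lt ht.2⟩
  rw [rateTime, this]
  simp

end Sections

/-! ### Weak morphisms and the category `RWFlowGS` -/

/-- A weak morphism of flows: a continuous map `toFun` together with a time change `time`. -/
@[ext]
structure WeakFlowHom {X Y : Type u} [TopologicalSpace X] [TopologicalSpace Y]
    (Φ : Flow ℝ X) (Ψ : Flow ℝ Y) where
  toFun : X → Y
  time : X → ℝ → ℝ
  continuous_toFun : Continuous toFun
  comm : ∀ x t, toFun (Φ t x) = Ψ (time x t) (toFun x)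
  isHomeomorph_time : ∀ x, IsHomeomorph (time x)
  strictMono_time : ∀ x, StrictMono (time x)
  time_zero : ∀ x, time x 0 = 0

/-- A flow on a topological manifold together with a global Poincaré section. -/
structure RWFlowGS : Type (u + 1) where
  carrier : Type u
  [top : TopologicalSpace carrier]
  manifold : IsTopManifold carrier
  flow : Flow ℝ carrier
  sec : Set carrier
  isSection : IsGlobalPoincareSection flow sec

attribute [instance] RWFlowGS.top

namespace RWFlowGS

/-- A rate-preserving morphism: a weak morphism `(h, σ)` that preserves the sections
(`S₁ = h⁻¹ S₂`) and satisfies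
`σ(Φ₁(x, t T₁(x)), ∫₀^{s+t} R₁(x) - t T₁(x)) = ∫₀^{s+t} R₂(h x) - t T₂(h x)`. -/
@[ext]
structure Hom (A B : RWFlowGS.{u}) extends WeakFlowHom A.flow B.flow where
  preserves : A.sec = toFun ⁻¹' B.sec
  ratePreserving : ∀ (x : A.carrier) (hx : x ∈ A.sec) (t s : ℝ), 0 ≤ t → t < 1 →
    time (A.flow (t * returnTime A.flow A.sec x) x) (rateTime A.isSection ⟨x, hx⟩ t s) =
      rateTime B.isSection ⟨toFun x, (Set.ext_iff.1 preserves x).1 hx⟩ t s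

variable {A B C : RWFlowGS.{u}}

theorem Hom.mapsTo (f : Hom A B) {x : A.carrier} (hx : x ∈ A.sec) : f.toFun x ∈ B.sec :=
  (Set.ext_iff.1 f.preserves x).1 hx

theorem Hom.time_mul_returnTime (f : Hom A B) {x : A.carrier} (hx : x ∈ A.sec) {t : ℝ}
    (h0 : 0 ≤ t) (h1 : t < 1) :
    f.time x (t * returnTime A.flow A.sec x) = t * returnTime B.flow B.sec (f.toFun x) := by
  have h := f.ratePreserving x hx 0 t le_rfl one_pos
  rw [rateTime_zero _ _ ⟨h0, h1⟩, rateTime_zero _ _ ⟨h0, h1⟩, zero_mul,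
    A.flow.map_zero_apply] at h
  exact h

theorem Hom.time_returnTime (f : Hom A B) {x : A.carrier} (hx : x ∈ A.sec) :
    f.time x (returnTime A.flow A.sec x) = returnTime B.flow B.sec (f.toFun x) := by
  have hA := A.isSection.isLeast_returnTime hx
  have hB := B.isSection.isLeast_returnTime (f.mapsTo hx)
  apply le_antisymm
  · obtain ⟨t, ht⟩ := (f.isHomeomorph_time x).surjective (returnTime B.flow B.sec (f.toFun x))
    have ht0 : 0 < t := by
      rw [← (f.strictMono_time x).lt_iff_lt, f.time_zero, ht]
      exact hB.1.1
    rw [← ht, (f.strictMono_time x).le_iff_le]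
    refine hA.2 ⟨ht0, (Set.ext_iff.1 f.preserves _).2 ?_⟩
    rw [Set.mem_preimage, f.comm, ht]
    exact hB.1.2
  · refine hB.2 ⟨?_, ?_⟩
    · rw [← f.time_zero x, (f.strictMono_time x).lt_iff_lt]
      exact hA.1.1
    · rw [← f.comm]
      exact f.mapsTo hA.1.2

/-- The category of flows with global Poincaré sections and rate-preserving morphisms. The
composite of `(h₁, τ₁)` and `(h₂, τ₂)` has time part `τ₂(h₁(x), τ₁(x, t))`. -/
instance category : Category RWFlowGS.{u} where
  Hom A B := Hom A B
  id A :=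
    { toFun := id
      time := fun _ => id
      continuous_toFun := continuous_id
      comm := fun _ _ => rfl
      isHomeomorph_time := fun _ => (Homeomorph.refl ℝ).isHomeomorph
      strictMono_time := fun _ => strictMono_id
      time_zero := fun _ => rfl
      preserves := rfl
      ratePreserving := fun _ _ _ _ _ _ => rfl }
  comp f g :=
    { toFun := g.toFun ∘ f.toFun
      time := fun x => g.time (f.toFun x) ∘ f.time x
      continuous_toFun := g.continuous_toFun.comp f.continuous_toFun
      comm := fun x t => by simp [f.comm, g.comm]
      isHomeomorph_time := fun x => (g.isHomeomorph_time _).comp (f.isHomeomorph_time x)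
      strictMono_time := fun x => (g.strictMono_time _).comp (f.strictMono_time x)
      time_zero := fun x => by simp [f.time_zero, g.time_zero]
      preserves := by rw [f.preserves, g.preserves, Set.preimage_comp]
      ratePreserving := fun x hx t s h0 h1 => by
        simp only [Function.comp_apply]
        rw [f.ratePreserving x hx t s h0 h1, f.comm, f.time_mul_returnTime hx h0 h1,
          g.ratePreserving _ (f.mapsTo hx) t s h0 h1] }

end RWFlowGS

/-! ### The Poincaré map functor -/

/-- The Poincaré map of a global section is a self-homeomorphism of a topological manifold. -/
def PoincareWellDefined : Prop :=
  ∀ A : RWFlowGS.{u}, IsTopManifold A.sec ∧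
    Continuous (poincareMap A.isSection) ∧ Continuous (poincareMap A.isSection).symm

/-- The functor `P`, sending `(Φ, X, S)` to `(PΦ, S)` and `(h, σ)` to the restriction of `h`. -/
noncomputable def poincareFunctor (hP : PoincareWellDefined.{u}) :
    RWFlowGS.{u} ⥤ MapDS.{u} where
  obj A :=
    { carrier := A.sec
      manifold := (hP A).1
      map := ⟨poincareMap A.isSection, (hP A).2.1, (hP A).2.2⟩ }
  map {A B} f :=
    { toFun := fun x => ⟨(RWFlowGS.Hom.toWeakFlowHom f).toFun x, RWFlowGS.Hom.mapsTo f x.2⟩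
      continuous_toFun :=
        ((RWFlowGS.Hom.toWeakFlowHom f).continuous_toFun.comp continuous_subtype_val).subtype_mk _
      comm := fun x => Subtype.ext <| by
        change (RWFlowGS.Hom.toWeakFlowHom f).toFun (A.flow (returnTime A.flow A.sec x) x) =
          B.flow (returnTime B.flow B.sec ((RWFlowGS.Hom.toWeakFlowHom f).toFun x)) ((RWFlowGS.Hom.toWeakFlowHom f).toFun x)
        rw [(RWFlowGS.Hom.toWeakFlowHom f).comm, RWFlowGS.Hom.time_returnTime f x.2] }

/-! ### Mapping tori and suspension flows -/

section Suspension

variable {X : Type u} [TopologicalSpace X]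

/-- The relation generating the identification `(x, 1) ∼ (f x, 0)` on `X × [0, 1]`. -/
inductive MappingTorusRel (f : X ≃ₜ X) : X × unitInterval → X × unitInterval → Prop
  | glue (x : X) : MappingTorusRel f (x, 1) (f x, 0)

/-- The mapping torus: the quotient of `X × [0, 1]` by the smallest equivalence relation with
`(x, 1) ∼ (f x, 0)`, with the quotient topology. -/
def MappingTorus (f : X ≃ₜ X) : Type u := Quot (MappingTorusRel f)

instance MappingTorus.instTopologicalSpace (f : X ≃ₜ X) : TopologicalSpace (MappingTorus f) :=
  inferInstanceAs (TopologicalSpace (Quot (MappingTorusRel f)))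

namespace MappingTorus

variable (f : X ≃ₜ X)

/-- The point `[x, t]`. -/
def mk (x : X) (t : unitInterval) : MappingTorus f := Quot.mk _ (x, t)

/-- The point `[x, fract r]`, for a real number `r`. -/
noncomputable def mkFract (x : X) (r : ℝ) : MappingTorus f :=
  mk f x ⟨Int.fract r, Int.fract_nonneg r, (Int.fract_lt_one r).le⟩

theorem mk_one (x : X) : mk f x 1 = mk f (f x) 0 := Quot.sound (.glue x)

theorem zpow_add_one_apply (n : ℤ) (x : X) : (f ^ (n + 1)) x = (f ^ n) (f x) := by
  rw [zpow_add_one]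
  rfl

theorem zpow_comm_apply {Y : Type u} [TopologicalSpace Y] {g : Y ≃ₜ Y} {h : X → Y}
    (hc : ∀ x, h (f x) = g (h x)) (n : ℤ) (x : X) : h ((f ^ n) x) = (g ^ n) (h x) := by
  induction n generalizing x with
  | zero => rfl
  | succ n ih => rw [zpow_add_one_apply, zpow_add_one_apply, ih, hc]
  | pred n ih =>
    have e : ∀ {Z : Type u} [TopologicalSpace Z] (k : Z ≃ₜ Z) (z : Z),
        (k ^ (-(n : ℤ) - 1)) z = (k ^ (-(n : ℤ))) (k.symm z) := by
      intro Z _ k z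
      rw [zpow_sub_one]
      rfl
    rw [e, e, ih]
    congr 1
    rw [Homeomorph.eq_symm_apply, ← hc, Homeomorph.apply_symm_apply]

/-- The suspension: `Σf([x, t], s) = [f^n x, s + t - n]` with `n = ⌊s + t⌋`, the integer with
`s + t - 1 < n ≤ s + t`. -/
noncomputable def suspend (s : ℝ) : MappingTorus f → MappingTorus f :=
  Quot.lift (fun p => mkFract f ((f ^ ⌊s + (p.2 : ℝ)⌋) p.1) (s + p.2)) <| by
    rintro _ _ ⟨x⟩
    simp [mkFract, zpow_add_one_apply]

theorem suspend_mk (s : ℝ) (x : X) (t : unitInterval) :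
    suspend f s (mk f x t) = mkFract f ((f ^ ⌊s + (t : ℝ)⌋) x) (s + t) := rfl

theorem suspend_zero (p : MappingTorus f) : suspend f 0 p = p := by
  obtain ⟨x, t, rfl⟩ : ∃ x t, mk f x t = p := by
    obtain ⟨⟨x, t⟩, h⟩ := Quot.exists_rep p
    exact ⟨x, t, h⟩
  rw [suspend_mk]
  rcases t.2.2.eq_or_lt with h | h
  · have ht : t = 1 := Subtype.ext h
    subst ht
    rw [mk_one]
    simp [mkFract]
  · have h0 : ⌊(t : ℝ)⌋ = 0 := Int.floor_eq_zero_iff.2 ⟨t.2.1, h⟩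
    simp [mkFract, h0, Int.fract_eq_self.2 ⟨t.2.1, h⟩]

theorem suspend_add (s r : ℝ) (p : MappingTorus f) :
    suspend f (s + r) p = suspend f s (suspend f r p) := by
  obtain ⟨x, t, rfl⟩ : ∃ x t, mk f x t = p := by
    obtain ⟨⟨x, t⟩, h⟩ := Quot.exists_rep p
    exact ⟨x, t, h⟩
  rw [suspend_mk, suspend_mk, mkFract, mkFract, suspend_mk, mkFract]
  have e : s + r + (t : ℝ) = (s + Int.fract (r + (t : ℝ))) + (⌊r + (t : ℝ)⌋ : ℤ) := by
    have := Int.floor_add_fract (r + (t : ℝ))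
    linarith
  simp only [e, Int.floor_add_intCast, Int.fract_add_intCast, zpow_add, Homeomorph.mul_apply]

/-- The section `(X_f)₀ = {[x, 0]}`. -/
def zeroSection : Set (MappingTorus f) := Set.range fun x => mk f x 0

theorem mk_mem_zeroSection (x : X) (t : unitInterval) :
    mk f x t ∈ zeroSection f ↔ t = 0 ∨ t = 1 := by
  constructor
  · rintro ⟨y, hy⟩
    let F : MappingTorus f → Prop := Quot.lift (fun p => p.2 = 0 ∨ p.2 = 1) <| by
      rintro _ _ ⟨z⟩
      simp
    have h0 : F (mk f y 0) := Or.inl rfl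
    change F (mk f x t)
    have hy' : mk f y 0 = mk f x t := hy
    rwa [hy'] at h0
  · rintro (rfl | rfl)
    · exact ⟨x, rfl⟩
    · exact ⟨f x, (mk_one f x).symm⟩

/-- The suspension flow on the mapping torus. -/
noncomputable def suspensionFlow
    (hc : Continuous fun q : ℝ × MappingTorus f => suspend f q.1 q.2) :
    Flow ℝ (MappingTorus f) where
  toFun := suspend f
  cont' := hc
  map_add' := suspend_add f
  map_zero' := suspend_zero f

theorem returnTime_suspensionFlow
    (hc : Continuous fun q : ℝ × MappingTorus f => suspend f q.1 q.2)
    {p : MappingTorus f} (hp : p ∈ zeroSection f) :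
    returnTime (suspensionFlow f hc) (zeroSection f) p = 1 := by
  obtain ⟨x, rfl⟩ := hp
  have e : ∀ t : ℝ, suspensionFlow f hc t (mk f x 0) ∈ zeroSection f ↔ Int.fract t = 0 := by
    intro t
    change suspend f t (mk f x 0) ∈ _ ↔ _
    rw [suspend_mk, mkFract, mk_mem_zeroSection]
    simp [Subtype.ext_iff, (Int.fract_lt_one t).ne]
  apply le_antisymm
  · exact csInf_le ⟨0, fun t ht => ht.1.le⟩ ⟨one_pos, (e 1).2 Int.fract_one⟩
  · refine le_csInf ⟨1, one_pos, (e 1).2 Int.fract_one⟩ ?_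
    rintro t ⟨h0, h1⟩
    obtain ⟨n, rfl⟩ := Int.fract_eq_zero_iff.1 ((e t).1 h1)
    have : 0 < n := by exact_mod_cast h0
    exact_mod_cast this

/-- The map `[x, t] ↦ [h x, t]` of mapping tori. -/
def lift {Y : Type u} [TopologicalSpace Y] {f : X ≃ₜ X} {g : Y ≃ₜ Y} (h : X → Y)
    (hc : ∀ x, h (f x) = g (h x)) : MappingTorus f → MappingTorus g :=
  Quot.lift (fun p => mk g (h p.1) p.2) <| by
    rintro _ _ ⟨x⟩
    simp only [hc]
    exact mk_one g (h x)

end MappingTorus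

end Suspension

open MappingTorus in
/-- For every map dynamical system `(f, X)`, the mapping torus `X_f` is a topological manifold, the
suspension flow is continuous, and `(X_f)₀` is a global Poincaré section of it. -/
def SuspensionWellDefined : Prop :=
  ∀ M : MapDS.{u}, IsTopManifold (MappingTorus M.map) ∧
    ∃ hc : Continuous fun q : ℝ × MappingTorus M.map => suspend M.map q.1 q.2,
      IsGlobalPoincareSection (suspensionFlow M.map hc) (zeroSection M.map)

open MappingTorus in
/-- The object `(Σf, X_f, (X_f)₀)`. -/
noncomputable def suspensionObj (hS : SuspensionWellDefined.{u}) (M : MapDS.{u}) :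
    RWFlowGS.{u} where
  carrier := MappingTorus M.map
  manifold := (hS M).1
  flow := suspensionFlow M.map (hS M).2.1
  sec := zeroSection M.map
  isSection := (hS M).2.2

open MappingTorus in
theorem rateTime_suspensionObj (hS : SuspensionWellDefined.{u}) (M : MapDS.{u})
    (x : (suspensionObj hS M).sec) (t s : ℝ) :
    rateTime (suspensionObj hS M).isSection x t s =
      (∫ u in (0 : ℝ)..(s + t), ∑' i : ℤ, 1 * Set.indicator (Set.Ico (i : ℝ) (i + 1)) 1 u)
        - t * 1 := by
  have h : ∀ y : (suspensionObj hS M).sec,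
      returnTime (suspensionObj hS M).flow (suspensionObj hS M).sec y = 1 := fun y =>
    returnTime_suspensionFlow M.map (hS M).2.1 y.2
  simp only [rateTime, returnRate, h]

open MappingTorus in
/-- The suspension functor `Σ`, followed by the inclusion into `RWFlowGS`: it sends `(f, X)` to
`(Σf, X_f, (X_f)₀)` and `h` to `[x, t] ↦ [h x, t]` with identity time part. -/
noncomputable def suspensionFunctor (hS : SuspensionWellDefined.{u}) :
    MapDS.{u} ⥤ RWFlowGS.{u} where
  obj M := suspensionObj hS M
  map {M N} h :=
    { toFun := MappingTorus.lift (MapDS.Hom.toFun h) (MapDS.Hom.comm h)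
      time := fun _ => id
      continuous_toFun := by
        refine continuous_quot_lift _ ?_
        exact continuous_quot_mk.comp
          (((MapDS.Hom.continuous_toFun h).comp continuous_fst).prodMk continuous_snd)
      comm := by
        rintro ⟨x, t⟩ s
        change MappingTorus.lift _ _ (suspend M.map s (mk M.map x t)) =
          suspend N.map s (mk N.map (MapDS.Hom.toFun h x) t)
        rw [suspend_mk, suspend_mk, ← zpow_comm_apply M.map (MapDS.Hom.comm h)]
        rfl
      isHomeomorph_time := fun _ => (Homeomorph.refl ℝ).isHomeomorph
      strictMono_time := fun _ => strictMono_id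
      time_zero := fun _ => rfl
      preserves := by
        ext ⟨x, t⟩
        change mk M.map x t ∈ zeroSection M.map ↔
          mk N.map (MapDS.Hom.toFun h x) t ∈ zeroSection N.map
        rw [mk_mem_zeroSection, mk_mem_zeroSection]
      ratePreserving := by
        intro x hx t s _ _
        rw [id, rateTime_suspensionObj, rateTime_suspensionObj] }
  map_id M := by
    apply RWFlowGS.Hom.ext
    · funext p
      obtain ⟨q, rfl⟩ := Quot.exists_rep p
      rfl
    · rfl
  map_comp f g := by
    apply RWFlowGS.Hom.ext
    · funext p
      obtain ⟨q, rfl⟩ := Quot.exists_rep p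
      rfl
    · rfl

/-! ### Consequences of transversality: return time and Poincaré map are continuous -/

section Sections

variable {X : Type u} [TopologicalSpace X] {Φ : Flow ℝ X} {S : Set X}

/-! Transversality enters the analysis through two local facts near a point of the section: nearby
section points stay off the section for a uniform time (`eventually_gap`), and every nearby orbit
crosses the section near that point after a short time (`eventually_exists_hit`). Together they make
the return time continuous and the Poincaré map a homeomorphism; crossing also makes the flow `S × ℝ
→ X` an open map. Flat charts make `S` a manifold.

The mapping torus is best seen as the quotient of `X × ℝ` by the ℤ-action `(x, r) ↦ (f^n x, r - n)`.
The projection `cover` is an open quotient map, injective on strips of width one, and it turns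
suspension into translation of `r`. Continuity of the flow, the Hausdorff property, the charts and
transversality of the zero section are all read off upstairs.

For a flow with a section, `cumTime x r`, the integral of the return rate over `[0, r]`, is an
increasing homeomorphism in `r`; it is onto because visits to `S` cannot accumulate. Its cocycle
identity under the Poincaré map makes `(x, r) ↦ Φ (cumTime x r) x` descend to the torus. The result
is bijective, since each point lies on exactly one half-open return arc, and open, as a composite of
open maps upstairs (`isHomeomorph_torusMap`). This is the counit; upstairs its time change is
`cumTime x (s + r) - cumTime x r`.

Finally, rate preservation forces a morphism to be determined on the section (`Hom.ext_of_eqOn`),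
where the counit is just `[x, 0] ↦ x`. Counit naturality and the left triangle are therefore checked
on the section. A rate-preserving morphism whose underlying map is a homeomorphism is invertible, so
unit and counit are isomorphisms. -/

theorem IsTopManifold.locallyConnectedSpace (h : IsTopManifold X) : LocallyConnectedSpace X := by
  obtain ⟨n, -, -, ⟨c⟩⟩ := h
  exact ChartedSpace.locallyConnectedSpace (EuclideanSpace ℝ (Fin n)) X

namespace IsGlobalPoincareSection

theorem isTopManifold (h : IsGlobalPoincareSection Φ S) : IsTopManifold X := by
  obtain ⟨m, hm, -⟩ := h.transversal
  exact ⟨m + 1, hm⟩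

/-- Near a point of the section, all points of the section stay off it for a uniform time. -/
theorem eventually_gap (h : IsGlobalPoincareSection Φ S) {x : X} (hx : x ∈ S) :
    ∃ δ > 0, ∀ᶠ y in 𝓝 x, y ∈ S → ∀ t : ℝ, 0 < |t| → |t| ≤ δ → Φ t y ∉ S := by
  obtain ⟨m, -, -, ⟨δp, δm, H⟩, -⟩ := h.transversal
  obtain ⟨-, -, φ, -, -, -, -, -, V, hV, -, δ, hδ, hVδ⟩ := H x hx
  refine ⟨δ, hδ, ?_⟩
  filter_upwards [hV] with y hyV hyS t ht0 ht
  obtain ⟨h1, h2⟩ := hVδ y ⟨hyV, hyS⟩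
  obtain ⟨-, -, φ, -, -, -, ⟨a, -, b, -, -, ha, hb⟩, -⟩ := H y hyS
  rcases lt_or_gt_of_ne (abs_pos.mp ht0) with h0 | h0
  · rw [abs_of_neg h0] at ht
    exact (connectedComponentIn_subset _ _ (ha t ⟨by linarith, h0⟩)).2
  · rw [abs_of_pos h0] at ht
    exact (connectedComponentIn_subset _ _ (hb t ⟨h0, by linarith⟩)).2

/-- Orbits passing close to a point `x` of the section cross the section close to `x`. -/
theorem eventually_exists_hit (h : IsGlobalPoincareSection Φ S) {x : X} (hx : x ∈ S)
    {ε : ℝ} (hε : 0 < ε) {W : Set X} (hW : W ∈ 𝓝 x) :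
    ∀ᶠ q in 𝓝 x, ∃ s : ℝ, |s| < ε ∧ Φ s q ∈ S ∧ Φ s q ∈ W := by
  have := h.isTopManifold.locallyConnectedSpace
  obtain ⟨m, -, -, ⟨δp, δm, H⟩, -⟩ := h.transversal
  obtain ⟨hp, hm, φ, hxφ, -, -, ⟨a, ha', b, hb', hab, ha, hb⟩, -, -⟩ := H x hx
  have hUo : IsOpen (φ.source \ S) := φ.open_source.sdiff h.isClosed
  have hcont : Continuous fun p : ℝ × X => Φ p.1 p.2 := Φ.continuous continuous_fst continuous_snd
  have hWU : ∀ᶠ p : ℝ × X in 𝓝 0 ×ˢ 𝓝 x, Φ p.1 p.2 ∈ W ∩ φ.source := by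
    rw [← nhds_prod_eq]
    refine hcont.continuousAt.preimage_mem_nhds (x := ((0 : ℝ), x)) ?_
    simp only [Φ.map_zero_apply]
    exact Filter.inter_mem hW (φ.open_source.mem_nhds hxφ)
  obtain ⟨P, hP, Q, hQ, hPQ⟩ := Filter.eventually_prod_iff.1 hWU
  obtain ⟨r, hr, hrP⟩ := Metric.eventually_nhds_iff.1 hP
  obtain ⟨e, he0, he⟩ : ∃ e > 0, e < min (min r ε) (min (δp x) (-δm x)) :=
    exists_between (lt_min (lt_min hr hε) (lt_min hp (by linarith)))
  simp only [lt_min_iff] at he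
  -- Components of the open set `φ.source \ S` are open by local connectedness, so the two endpoints
  -- of a nearby arc stay in the components of the endpoints for `x`.
  have hopen : ∀ (c : X) (t : ℝ), Φ t x ∈ connectedComponentIn (φ.source \ S) c →
      ∀ᶠ q in 𝓝 x, Φ t q ∈ connectedComponentIn (φ.source \ S) c := fun c t ht =>
    (Φ.continuous continuous_const continuous_id).continuousAt.preimage_mem_nhds
      (hUo.connectedComponentIn.mem_nhds ht)
  filter_upwards [hQ, hopen a (-e) (ha _ ⟨by linarith, by linarith⟩),
    hopen b e (hb _ ⟨by linarith, by linarith⟩)] with q hq hqa hqb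
  have hin : ∀ s ∈ Set.Icc (-e) e, Φ s q ∈ W ∩ φ.source := by
    intro s hs
    refine hPQ (hrP ?_) hq
    rw [Real.dist_eq, sub_zero]
    exact (abs_le.2 hs).trans_lt he.1.1
  by_contra hno
  push Not at hno
  -- An arc that missed `S` would be a connected set joining two different components.
  have hsub : (fun s => Φ s q) '' Set.Icc (-e) e ⊆ φ.source \ S := by
    rintro _ ⟨s, hs, rfl⟩
    exact ⟨(hin s hs).2, fun hS => hno s ((abs_le.2 hs).trans_lt he.1.2) hS (hin s hs).1⟩
  have hpre : IsPreconnected ((fun s => Φ s q) '' Set.Icc (-e) e) :=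
    isPreconnected_Icc.image _ (Φ.continuous continuous_id continuous_const).continuousOn
  have hmem := hpre.subset_connectedComponentIn
    (Set.mem_image_of_mem _ (Set.left_mem_Icc.2 (by linarith))) hsub
    (Set.mem_image_of_mem _ (Set.right_mem_Icc.2 (by linarith)))
  apply hab
  rw [connectedComponentIn_eq hqa, connectedComponentIn_eq hqb]
  exact connectedComponentIn_eq hmem

theorem returnTime_pos (h : IsGlobalPoincareSection Φ S) (x : S) : 0 < returnTime Φ S x :=
  (h.isLeast_returnTime x.2).1.1

theorem returnTime_le (h : IsGlobalPoincareSection Φ S) (x : S) {t : ℝ} (ht : 0 < t)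
    (hS : Φ t x ∈ S) : returnTime Φ S x ≤ t :=
  (h.isLeast_returnTime x.2).2 ⟨ht, hS⟩

theorem continuous_flow (Φ : Flow ℝ X) : Continuous fun p : ℝ × X => Φ p.1 p.2 :=
  Φ.continuous continuous_fst continuous_snd

/-- Lower semicontinuity: the uniform gap excludes returns before `δ`, and compactness of `[δ, c]`
excludes them up to any `c` below the return time. Upper semicontinuity: a nearby orbit must cross
the section near the first return point. -/
theorem continuous_returnTime (h : IsGlobalPoincareSection Φ S) :
    Continuous fun x : S => returnTime Φ S x := by
  refine continuous_iff_continuousAt.2 fun x => ?_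
  have hT := h.returnTime_pos x
  refine tendsto_order.2 ⟨fun c hc => ?_, fun c hc => ?_⟩
  · obtain ⟨δ, hδ, hgap⟩ := h.eventually_gap x.2
    have hK : ∀ᶠ y in 𝓝 (x : X), ∀ t ∈ Set.Icc δ c, Φ t y ∉ S := by
      refine isCompact_Icc.eventually_forall_of_forall_eventually fun t ht => ?_
      refine ((continuous_flow Φ).comp continuous_swap).continuousAt.preimage_mem_nhds
        (h.isClosed.isOpen_compl.mem_nhds fun hS => ?_)
      exact (h.returnTime_le x (hδ.trans_le ht.1) hS).not_gt (ht.2.trans_lt hc)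
    filter_upwards [continuous_subtype_val.continuousAt.eventually hgap,
      continuous_subtype_val.continuousAt.eventually hK] with y hy1 hy2
    by_contra! hle
    have hy := (h.isLeast_returnTime y.2).1
    rcases le_total δ (returnTime Φ S y) with h1 | h1
    · exact hy2 _ ⟨h1, hle⟩ hy.2
    · exact hy1 y.2 _ (abs_pos.2 hy.1.ne') (by rwa [abs_of_pos hy.1]) hy.2
  -- The first bound keeps the perturbed hitting time below `c`, the second keeps it positive so
  -- that it counts as a return.
  · have hε : 0 < min (c - returnTime Φ S x) (returnTime Φ S x) := lt_min (sub_pos.2 hc) hT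
    have hev := h.eventually_exists_hit (h.isLeast_returnTime x.2).1.2 hε Filter.univ_mem
    have hcont : Continuous fun y : S => Φ (returnTime Φ S x) y :=
      Φ.continuous continuous_const continuous_subtype_val
    filter_upwards [hcont.continuousAt.eventually hev] with y hy
    obtain ⟨s, hs, hsS, -⟩ := hy
    rw [lt_min_iff, abs_lt, abs_lt] at hs
    rw [← Φ.map_add] at hsS
    exact (h.returnTime_le y (by linarith) hsS).trans_lt (by linarith)

theorem continuous_poincareMap (h : IsGlobalPoincareSection Φ S) :
    Continuous (poincareMap h) :=
  (Φ.continuous h.continuous_returnTime continuous_subtype_val).subtype_mk _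

theorem coe_poincareMap (h : IsGlobalPoincareSection Φ S) (x : S) :
    (poincareMap h x : X) = Φ (returnTime Φ S x) x := rfl

/-- Flowing a point `z` near `P x` back by `T` and correcting by a small `s` gives a section point
`y` near `x`. Its image `P y` lies on the orbit of `z` at a time smaller than the gap, hence equals
`z`. -/
theorem continuous_poincareMap_symm (h : IsGlobalPoincareSection Φ S) :
    Continuous (poincareMap h).symm := by
  refine continuous_iff_continuousAt.2 fun z => ?_
  obtain ⟨x, rfl⟩ := (poincareMap h).surjective z
  set T := returnTime Φ S x
  rw [ContinuousAt, Equiv.symm_apply_apply]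
  intro W hW
  obtain ⟨δ, hδ, hgap⟩ := h.eventually_gap (poincareMap h x).2
  have hW' : {y : S | y ∈ W ∧ |returnTime Φ S y - T| < δ / 2} ∈ 𝓝 x := by
    refine Filter.inter_mem hW ?_
    filter_upwards [Metric.tendsto_nhds.1 (h.continuous_returnTime.continuousAt (x := x)) (δ / 2)
      (by positivity)] with y hy
    rwa [Real.dist_eq] at hy
  obtain ⟨W₁, hW₁, hsub⟩ := mem_nhds_subtype S x _ |>.1 hW'
  have hev := h.eventually_exists_hit x.2 (show 0 < δ / 2 by positivity) hW₁
  have hcont : Continuous fun z : S => Φ (-T) z :=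
    Φ.continuous continuous_const continuous_subtype_val
  have hx : Φ (-T) (poincareMap h x) = (x : X) := by
    rw [coe_poincareMap, ← Φ.map_add, neg_add_cancel, Φ.map_zero_apply]
  have hev2 := (hcont.tendsto (poincareMap h x)).eventually (by rw [hx]; exact hev)
  refine Filter.mem_map.2 ?_
  filter_upwards [hev2, continuous_subtype_val.continuousAt.eventually hgap] with z hz1 hz2
  obtain ⟨s, hs, hsS, hsW⟩ := hz1
  rw [← Φ.map_add] at hsS hsW
  obtain ⟨hyW, hyT⟩ := hsub (show (⟨_, hsS⟩ : S) ∈ Subtype.val ⁻¹' W₁ from hsW)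
  have key : poincareMap h ⟨_, hsS⟩ = z := by
    have e : (poincareMap h ⟨_, hsS⟩ : X) =
        Φ (returnTime Φ S (Φ (s + -T) z) + (s + -T)) z := by
      rw [coe_poincareMap, ← Φ.map_add]
    -- Both `s` and the deviation of the return time from `T` are below `δ / 2`, so a nonzero sum
    -- would violate the gap at `z`.
    have h0 : returnTime Φ S (Φ (s + -T) z) + (s + -T) = 0 := by
      by_contra hne
      refine hz2 z.2 _ (abs_pos.2 hne) ?_ (by rw [← e]; exact Subtype.coe_prop _)
      rw [abs_lt] at hs hyT
      rw [abs_le]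
      constructor <;> linarith [hs.1, hs.2, hyT.1, hyT.2]
    exact Subtype.ext (by rw [e, h0, Φ.map_zero_apply])
  change (poincareMap h).symm z ∈ W
  rw [← key, Equiv.symm_apply_apply]
  exact hyW

end IsGlobalPoincareSection

end Sections

/-! ### The section is a manifold -/

theorem nonempty_chartedSpace {X H : Type*} [TopologicalSpace X] [TopologicalSpace H]
    (h : ∀ x : X, ∃ φ : OpenPartialHomeomorph X H, x ∈ φ.source) :
    Nonempty (ChartedSpace H X) := by
  choose φ hφ using h
  exact ⟨{ atlas := Set.range φ
           chartAt := φ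
           mem_chart_source := hφ
           chart_mem_atlas := fun x => ⟨x, rfl⟩ }⟩

/-- Appending a last coordinate, as a homeomorphism `ℝᵐ × ℝ ≃ ℝᵐ⁺¹`. -/
def euclideanSnoc (m : ℕ) :
    EuclideanSpace ℝ (Fin m) × ℝ ≃ₜ EuclideanSpace ℝ (Fin (m + 1)) where
  toFun p := WithLp.toLp 2 (Fin.snoc (α := fun _ => ℝ) p.1.ofLp p.2)
  invFun v := (WithLp.toLp 2 fun i => v (Fin.castSucc i), v (Fin.last m))
  left_inv p := by ext <;> simp
  right_inv v := by
    ext i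
    refine Fin.lastCases ?_ (fun j => ?_) i <;> simp
  continuous_toFun := by
    refine (PiLp.continuous_toLp 2 _).comp (continuous_pi fun i => ?_)
    refine Fin.lastCases ?_ (fun j => ?_) i
    · simpa using continuous_snd
    · simp only [Fin.snoc_castSucc]
      fun_prop
  continuous_invFun := by fun_prop

@[simp]
theorem euclideanSnoc_last (m : ℕ) (p : EuclideanSpace ℝ (Fin m) × ℝ) :
    euclideanSnoc m p (Fin.last m) = p.2 := by
  simp [euclideanSnoc]

theorem euclideanSnoc_symm_snd (m : ℕ) (v : EuclideanSpace ℝ (Fin (m + 1))) :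
    ((euclideanSnoc m).symm v).2 = v (Fin.last m) := rfl

theorem norm_sq_euclideanSnoc (m : ℕ) (p : EuclideanSpace ℝ (Fin m) × ℝ) :
    ‖euclideanSnoc m p‖ ^ 2 = ‖p.1‖ ^ 2 + p.2 ^ 2 := by
  rw [EuclideanSpace.norm_sq_eq, EuclideanSpace.norm_sq_eq, Fin.sum_univ_castSucc]
  simp [euclideanSnoc]

section Sections

variable {X : Type u} [TopologicalSpace X] {Φ : Flow ℝ X} {S : Set X}

open Classical in
/-- The chart of a locally flat hypersurface induced by a flat chart of the ambient manifold. -/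
noncomputable def hypersurfaceChart {m : ℕ}
    (φ : OpenPartialHomeomorph X (EuclideanSpace ℝ (Fin (m + 1)))) (x : S)
    (hφ : ∀ y ∈ φ.source, y ∈ S ↔ φ y (Fin.last m) = 0) :
    OpenPartialHomeomorph S (EuclideanSpace ℝ (Fin m)) where
  toFun y := ((euclideanSnoc m).symm (φ y)).1
  -- The fallback `x` only makes the inverse total; on the target the first branch always applies.
  invFun v := if h : φ.symm (euclideanSnoc m (v, 0)) ∈ S then ⟨_, h⟩ else x
  source := Subtype.val ⁻¹' φ.source
  target := {v | euclideanSnoc m (v, 0) ∈ φ.target}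
  map_source' y hy := by
    have e : euclideanSnoc m (((euclideanSnoc m).symm (φ y)).1, 0) = φ y := by
      rw [← (hφ y hy).1 y.2, ← euclideanSnoc_symm_snd, Homeomorph.apply_symm_apply]
    change euclideanSnoc m _ ∈ φ.target
    rw [e]
    exact φ.map_source hy
  map_target' v hv := by
    have hS : φ.symm (euclideanSnoc m (v, 0)) ∈ S :=
      (hφ _ (φ.map_target hv)).2 (by rw [φ.right_inv hv, euclideanSnoc_last])
    rw [Set.mem_preimage, dif_pos hS]
    exact φ.map_target hv
  left_inv' y hy := by
    have e : euclideanSnoc m (((euclideanSnoc m).symm (φ y)).1, 0) = φ y := by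
      rw [← (hφ y hy).1 y.2, ← euclideanSnoc_symm_snd, Homeomorph.apply_symm_apply]
    have e' : φ.symm (euclideanSnoc m (((euclideanSnoc m).symm (φ y)).1, 0)) = y := by
      rw [e, φ.left_inv hy]
    rw [dif_pos (by rw [e']; exact y.2)]
    exact Subtype.ext e'
  right_inv' v hv := by
    have hS : φ.symm (euclideanSnoc m (v, 0)) ∈ S :=
      (hφ _ (φ.map_target hv)).2 (by rw [φ.right_inv hv, euclideanSnoc_last])
    rw [dif_pos hS, φ.right_inv hv, Homeomorph.symm_apply_apply]
  open_source := φ.open_source.preimage continuous_subtype_val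
  open_target := φ.open_target.preimage
    ((euclideanSnoc m).continuous.comp (continuous_id.prodMk continuous_const))
  continuousOn_toFun :=
    (continuous_fst.comp (euclideanSnoc m).symm.continuous).comp_continuousOn
      (φ.continuousOn.comp continuous_subtype_val.continuousOn fun _ hy => hy)
  continuousOn_invFun := by
    rw [IsEmbedding.subtypeVal.continuousOn_iff]
    refine (φ.continuousOn_symm.comp ((euclideanSnoc m).continuous.comp
      (continuous_id.prodMk continuous_const)).continuousOn fun v hv => hv).congr fun v hv => ?_
    have hS : φ.symm (euclideanSnoc m (v, 0)) ∈ S :=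
      (hφ _ (φ.map_target hv)).2 (by rw [φ.right_inv hv]; exact euclideanSnoc_last m _)
    simp only [Function.comp_apply, dif_pos hS, id]

theorem IsGlobalPoincareSection.isTopManifold_section (h : IsGlobalPoincareSection Φ S) :
    IsTopManifold S := by
  obtain ⟨m, ⟨hT2, hsc, -⟩, hflat, -⟩ := h.transversal
  refine ⟨m, inferInstance, inferInstance, nonempty_chartedSpace fun x => ?_⟩
  obtain ⟨φ, hx, hφ⟩ := hflat x x.2
  exact ⟨hypersurfaceChart φ x hφ, hx⟩

theorem poincareWellDefined : PoincareWellDefined.{u} := fun A =>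
  ⟨A.isSection.isTopManifold_section, A.isSection.continuous_poincareMap,
    A.isSection.continuous_poincareMap_symm⟩

end Sections

/-! ### Accumulated return time along an orbit -/

section Sections

variable {X : Type u} [TopologicalSpace X] {Φ : Flow ℝ X} {S : Set X}

namespace IsGlobalPoincareSection

theorem returnRate_eq (h : IsGlobalPoincareSection Φ S) (x : S) (u : ℝ) :
    returnRate h x u = returnTime Φ S ((poincareMap h ^ ⌊u⌋) x : S) := by
  unfold returnRate
  rw [tsum_eq_single ⌊u⌋]
  · simp [Int.floor_le, Int.lt_floor_add_one]
  · intro i hi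
    rw [Set.indicator_of_notMem, mul_zero]
    exact fun hu => hi (Int.floor_eq_iff.2 hu).symm

theorem returnRate_pos (h : IsGlobalPoincareSection Φ S) (x : S) (u : ℝ) :
    0 < returnRate h x u := by
  rw [returnRate_eq]
  exact h.returnTime_pos _

theorem returnRate_add_one (h : IsGlobalPoincareSection Φ S) (x : S) (u : ℝ) :
    returnRate h x (u + 1) = returnRate h (poincareMap h x) u := by
  rw [returnRate_eq, returnRate_eq, Int.floor_add_one, zpow_add_one, Equiv.Perm.mul_apply]

/-- The rate is constant on each `[n, n + 1)`, and finitely many such intervals cover `[a, b]`. -/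
theorem intervalIntegrable_returnRate (h : IsGlobalPoincareSection Φ S) (x : S) (a b : ℝ) :
    IntervalIntegrable (returnRate h x) MeasureTheory.volume a b := by
  have hunit : ∀ n : ℤ, IntervalIntegrable (returnRate h x) MeasureTheory.volume n (n + 1) := by
    intro n
    rw [intervalIntegrable_iff_integrableOn_Ico_of_le (by linarith)]
    refine (MeasureTheory.integrableOn_const (C := returnTime Φ S ((poincareMap h ^ n) x : S))
      (by simp)).congr_fun (fun u hu => ?_) measurableSet_Ico
    rw [returnRate_eq, Int.floor_eq_iff.2 hu]
  have hnat : ∀ (m : ℤ) (k : ℕ),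
      IntervalIntegrable (returnRate h x) MeasureTheory.volume m (m + k) := by
    intro m k
    induction k with
    | zero => simp
    | succ k ih =>
      refine ih.trans ?_
      have := hunit (m + k)
      push_cast at this ⊢
      rwa [← add_assoc]
  obtain ⟨k, hk⟩ := exists_nat_ge (max a b - ⌊min a b⌋)
  refine (hnat ⌊min a b⌋ k).mono_set ?_
  rw [Set.uIcc_of_le (a := (⌊min a b⌋ : ℝ)) (by simp)]
  exact Set.Icc_subset_Icc (Int.floor_le (min a b)) (by rw [sub_le_iff_le_add'] at hk; exact hk)

/-- The time needed by the orbit of `x ∈ S` to run through `r` returns. -/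
noncomputable def cumTime (h : IsGlobalPoincareSection Φ S) (x : S) (r : ℝ) : ℝ :=
  ∫ u in (0 : ℝ)..r, returnRate h x u

theorem rateTime_eq (h : IsGlobalPoincareSection Φ S) (x : S) (t s : ℝ) :
    rateTime h x t s = h.cumTime x (s + t) - t * returnTime Φ S x := rfl

theorem cumTime_zero (h : IsGlobalPoincareSection Φ S) (x : S) : h.cumTime x 0 = 0 :=
  intervalIntegral.integral_same

theorem continuous_cumTime (h : IsGlobalPoincareSection Φ S) (x : S) :
    Continuous (h.cumTime x) :=
  intervalIntegral.continuous_primitive (h.intervalIntegrable_returnRate x) 0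

theorem strictMono_cumTime (h : IsGlobalPoincareSection Φ S) (x : S) :
    StrictMono (h.cumTime x) := by
  intro a b hab
  have h1 := intervalIntegral.integral_add_adjacent_intervals
    (h.intervalIntegrable_returnRate x 0 a) (h.intervalIntegrable_returnRate x a b)
  have h2 := intervalIntegral.intervalIntegral_pos_of_pos
    (h.intervalIntegrable_returnRate x a b) (h.returnRate_pos x) hab
  unfold cumTime
  linarith

theorem cumTime_of_mem_Ico (h : IsGlobalPoincareSection Φ S) (x : S) {t : ℝ}
    (ht : t ∈ Set.Ico (0 : ℝ) 1) : h.cumTime x t = t * returnTime Φ S x := by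
  rw [← rateTime_zero h x ht, rateTime_eq, zero_mul, sub_zero, add_zero]

/-- The linear formula is available only for `t < 1`; continuity from the left carries it to the
endpoint. -/
theorem cumTime_one (h : IsGlobalPoincareSection Φ S) (x : S) :
    h.cumTime x 1 = returnTime Φ S x := by
  have h1 : Filter.Tendsto (h.cumTime x) (𝓝[<] 1) (𝓝 (h.cumTime x 1)) :=
    (h.continuous_cumTime x).continuousWithinAt
  have h2 : Filter.Tendsto (fun t : ℝ => t * returnTime Φ S x) (𝓝[<] 1)
      (𝓝 (1 * returnTime Φ S x)) :=
    (continuous_id.mul continuous_const).continuousWithinAt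
  rw [one_mul] at h2
  refine tendsto_nhds_unique_of_eventuallyEq h1 h2 ?_
  filter_upwards [Ico_mem_nhdsLT (zero_lt_one' ℝ)] with t ht
  exact h.cumTime_of_mem_Ico x ht

theorem cumTime_of_mem (h : IsGlobalPoincareSection Φ S) (x : S) {t : ℝ}
    (ht : t ∈ Set.Icc (0 : ℝ) 1) : h.cumTime x t = t * returnTime Φ S x := by
  rcases ht.2.eq_or_lt with rfl | h1
  · rw [cumTime_one, one_mul]
  · exact h.cumTime_of_mem_Ico x ⟨ht.1, h1⟩

theorem cumTime_add_one (h : IsGlobalPoincareSection Φ S) (x : S) (r : ℝ) :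
    h.cumTime x (r + 1) = returnTime Φ S x + h.cumTime (poincareMap h x) r := by
  have h1 := intervalIntegral.integral_add_adjacent_intervals
    (h.intervalIntegrable_returnRate x 0 1) (h.intervalIntegrable_returnRate x 1 (r + 1))
  have h2 : ∫ u in (1 : ℝ)..(r + 1), returnRate h x u = h.cumTime (poincareMap h x) r := by
    simp only [cumTime, ← returnRate_add_one]
    rw [intervalIntegral.integral_comp_add_right (returnRate h x), zero_add]
  rw [← cumTime_one, ← h2]
  exact h1.symm

theorem flow_cumTime_add_one (h : IsGlobalPoincareSection Φ S) (x : S) (r : ℝ) :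
    Φ (h.cumTime x (r + 1)) x = Φ (h.cumTime (poincareMap h x) r) (poincareMap h x) := by
  rw [cumTime_add_one, add_comm, Φ.map_add]
  rfl

/-- This invariance under the ℤ-action is what lets the reparametrised flow descend to the mapping
torus. -/
theorem flow_cumTime_add_int (h : IsGlobalPoincareSection Φ S) (x : S) (r : ℝ) (n : ℤ) :
    Φ (h.cumTime x (r + n)) x =
      Φ (h.cumTime ((poincareMap h ^ n) x) r) ((poincareMap h ^ n) x : S) := by
  induction n generalizing r with
  | zero => simp
  | succ n ih =>
    rw [Int.cast_add, Int.cast_one, ← add_assoc, add_right_comm, ih, flow_cumTime_add_one,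
      add_comm, zpow_one_add, Equiv.Perm.mul_apply]
  | pred n ih =>
    have e := h.flow_cumTime_add_one ((poincareMap h ^ (-(n : ℤ) - 1)) x) (r - 1)
    rw [← Equiv.Perm.mul_apply, ← zpow_one_add, add_sub_cancel, ← ih, sub_add_cancel] at e
    rw [e]
    congr 2
    push_cast
    ring

theorem flow_cumTime_int_mem (h : IsGlobalPoincareSection Φ S) (x : S) (n : ℤ) :
    Φ (h.cumTime x n) x ∈ S := by
  have := h.flow_cumTime_add_int x 0 n
  rw [zero_add, cumTime_zero, Φ.map_zero_apply] at this
  rw [this]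
  exact Subtype.coe_prop _

/-- Visits to `S` cannot accumulate in finite time: the limit point would lie in the closed set `S`,
and the gap there would force the visiting times to be eventually constant, against strict
monotonicity. -/
theorem not_tendsto_cumTime (h : IsGlobalPoincareSection Φ S) (x : S) {ι : ℕ → ℤ}
    (hι : Function.Injective ι) (c : ℝ) :
    ¬ Filter.Tendsto (fun n => h.cumTime x (ι n)) Filter.atTop (𝓝 c) := by
  intro hc
  have hz : Φ c x ∈ S := h.isClosed.mem_of_tendsto
    (((Φ.continuous continuous_id continuous_const).tendsto c).comp hc)
    (Filter.Eventually.of_forall fun n => h.flow_cumTime_int_mem x (ι n))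
  obtain ⟨δ, hδ, hgap⟩ := h.gap hz
  have hev : ∀ᶠ n in Filter.atTop, h.cumTime x (ι n) = c := by
    filter_upwards [Metric.tendsto_nhds.1 hc δ hδ] with n hn
    by_contra hne
    rw [Real.dist_eq] at hn
    refine hgap _ (abs_pos.2 (sub_ne_zero.2 hne)) hn.le ?_
    rw [← Φ.map_add, sub_add_cancel]
    exact h.flow_cumTime_int_mem x (ι n)
  obtain ⟨N, hN⟩ := Filter.eventually_atTop.1 hev
  have := (h.strictMono_cumTime x).injective ((hN N le_rfl).trans (hN (N + 1) (by omega)).symm)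
  have := hι (Int.cast_injective this)
  omega

theorem surjective_cumTime (h : IsGlobalPoincareSection Φ S) (x : S) :
    Function.Surjective (h.cumTime x) := by
  have hm := (h.strictMono_cumTime x).monotone
  refine (h.continuous_cumTime x).surjective ?_ ?_
  · rcases tendsto_atTop_of_monotone hm with h1 | ⟨l, hl⟩
    · exact h1
    · refine (h.not_tendsto_cumTime x (ι := fun n => (n : ℤ)) Nat.cast_injective l ?_).elim
      simpa [Function.comp_def] using hl.comp (tendsto_natCast_atTop_atTop (R := ℝ))
  · have hanti : Monotone fun r => -h.cumTime x (-r) := fun a b hab =>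
      neg_le_neg (hm (neg_le_neg hab))
    rcases tendsto_atTop_of_monotone hanti with h1 | ⟨l, hl⟩
    · have := Filter.tendsto_neg_atTop_atBot.comp (h1.comp Filter.tendsto_neg_atBot_atTop)
      simpa [Function.comp_def] using this
    · refine (h.not_tendsto_cumTime x (ι := fun n => -(n : ℤ))
        (neg_injective.comp Nat.cast_injective) (-l) ?_).elim
      simpa [Function.comp_def] using (hl.comp (tendsto_natCast_atTop_atTop (R := ℝ))).neg

theorem continuous_poincareMap_zpow (h : IsGlobalPoincareSection Φ S) (n : ℤ) :
    Continuous (poincareMap h ^ n : Equiv.Perm S) := by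
  induction n with
  | zero => exact continuous_id
  | succ n ih =>
    rw [zpow_add_one]
    exact ih.comp h.continuous_poincareMap
  | pred n ih =>
    rw [zpow_sub_one]
    exact ih.comp h.continuous_poincareMap_symm

/-- The cocycle identity over the ℤ-action of the Poincaré map, obtained by iterating the one-step
case in both directions. -/
theorem cumTime_add_int (h : IsGlobalPoincareSection Φ S) (x : S) (r : ℝ) (n : ℤ) :
    h.cumTime x (r + n) = h.cumTime x n + h.cumTime ((poincareMap h ^ n) x) r := by
  induction n generalizing r with
  | zero => simp [cumTime_zero]
  | succ n ih =>
    have e1 := h.cumTime_add_one ((poincareMap h ^ (n : ℤ)) x) r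
    rw [← Equiv.Perm.mul_apply, ← zpow_one_add, add_comm 1] at e1
    have e2 := ih (r + 1)
    have e3 := ih 1
    rw [cumTime_one] at e3
    push_cast at *
    rw [← add_assoc, add_right_comm, e2, e1, add_comm (n : ℝ) 1, e3]
    ring
  | pred n ih =>
    have e1 := h.cumTime_add_one ((poincareMap h ^ (-(n : ℤ) - 1)) x) (r - 1)
    have e1' := h.cumTime_add_one ((poincareMap h ^ (-(n : ℤ) - 1)) x) (-1)
    rw [← Equiv.Perm.mul_apply, ← zpow_one_add, add_sub_cancel] at e1 e1'
    have e2 := ih (r - 1)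
    have e3 := ih (-1)
    rw [sub_add_cancel] at e1
    rw [neg_add_cancel, cumTime_zero] at e1'
    push_cast at *
    rw [show r + (-(n : ℝ) - 1) = r - 1 + -n by ring, e2,
      show -(n : ℝ) - 1 = -1 + -n by ring, e3]
    linarith

theorem continuous_cumTime_left (h : IsGlobalPoincareSection Φ S) (r : ℝ) :
    Continuous fun x => h.cumTime x r := by
  have hint : ∀ n : ℕ, Continuous fun x => h.cumTime x n := by
    intro n
    induction n with
    | zero => simpa [cumTime_zero] using continuous_const
    | succ n ih =>
      simp only [Nat.cast_add, Nat.cast_one, cumTime_add_one]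
      exact h.continuous_returnTime.add (ih.comp h.continuous_poincareMap)
  have hint' : ∀ n : ℤ, Continuous fun x => h.cumTime x n := by
    intro n
    obtain ⟨k, rfl | rfl⟩ := n.eq_nat_or_neg
    · simpa using hint k
    -- The cocycle identity at `r = k`, `n = -k` has left side zero and so reduces negative integers
    -- to positive ones.
    · have e : ∀ x, h.cumTime x ((-(k : ℤ) : ℤ) : ℝ) =
          -h.cumTime ((poincareMap h ^ (-(k : ℤ))) x) k := by
        intro x
        have := h.cumTime_add_int x k (-(k : ℤ))
        rw [Int.cast_neg, Int.cast_natCast, add_neg_cancel, cumTime_zero] at this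
        rw [Int.cast_neg, Int.cast_natCast]
        linarith
      simp only [e]
      exact ((hint k).comp (h.continuous_poincareMap_zpow _)).neg
  have e : ∀ x, h.cumTime x r = h.cumTime x ⌊r⌋ +
      Int.fract r * returnTime Φ S ((poincareMap h ^ ⌊r⌋) x : S) := by
    intro x
    rw [← cumTime_of_mem h _ ⟨Int.fract_nonneg r, (Int.fract_lt_one r).le⟩, ← cumTime_add_int,
      Int.fract_add_floor]
  simp only [e]
  exact (hint' _).add (continuous_const.mul
    (h.continuous_returnTime.comp (h.continuous_poincareMap_zpow _)))

/-! ### Openness of the flow from the section, and return arcs -/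

theorem isOpenMap_prod_cumTime (h : IsGlobalPoincareSection Φ S) :
    IsOpenMap fun p : S × ℝ => (p.1, h.cumTime p.1 p.2) := by
  refine isOpenMap_iff_nhds_le.2 fun p => ?_
  intro V hV
  rw [Filter.mem_map, nhds_prod_eq] at hV
  obtain ⟨A, hA, B, hB, hAB⟩ := Filter.mem_prod_iff.1 hV
  obtain ⟨a, b, hab, hB'⟩ := mem_nhds_iff_exists_Ioo_subset.1 hB
  -- Continuity in the base point at the two fixed parameters `a`, `b` suffices: monotonicity in `r`
  -- then traps the preimage of `q.2` in `(a, b)`.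
  have h1 : ∀ᶠ q : S × ℝ in 𝓝 (p.1, h.cumTime p.1 p.2), h.cumTime q.1 a < q.2 :=
    ((h.continuous_cumTime_left a).comp continuous_fst).continuousAt.eventually_lt
      continuous_snd.continuousAt (h.strictMono_cumTime p.1 hab.1)
  have h2 : ∀ᶠ q : S × ℝ in 𝓝 (p.1, h.cumTime p.1 p.2), q.2 < h.cumTime q.1 b :=
    continuous_snd.continuousAt.eventually_lt
      ((h.continuous_cumTime_left b).comp continuous_fst).continuousAt
      (h.strictMono_cumTime p.1 hab.2)
  filter_upwards [h1, h2, continuous_fst.continuousAt.preimage_mem_nhds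
    (x := (p.1, h.cumTime p.1 p.2)) hA] with q hq1 hq2 hqA
  obtain ⟨r, hr⟩ := h.surjective_cumTime q.1 q.2
  rw [← hr] at hq1 hq2
  have := hAB (show (q.1, r) ∈ A ×ˢ B from ⟨hqA, hB'
    ⟨(h.strictMono_cumTime q.1).lt_iff_lt.1 hq1, (h.strictMono_cumTime q.1).lt_iff_lt.1 hq2⟩⟩)
  simpa only [Set.mem_preimage, hr] using this

/-- The flow restricted to the section is an open map `S × ℝ → X`. -/
theorem isOpenMap_flow (h : IsGlobalPoincareSection Φ S) :
    IsOpenMap fun p : S × ℝ => Φ p.2 p.1 := by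
  refine isOpenMap_iff_nhds_le.2 fun p => ?_
  intro V hV
  rw [Filter.mem_map, nhds_prod_eq] at hV
  obtain ⟨A, hA, B, hB, hAB⟩ := Filter.mem_prod_iff.1 hV
  obtain ⟨A₁, hA₁, hsub⟩ := mem_nhds_subtype S _ _ |>.1 hA
  obtain ⟨ε, hε, hB'⟩ := Metric.mem_nhds_iff.1 hB
  have hev := h.eventually_exists_hit p.1.2 hε hA₁
  have hcont : Continuous fun q : X => Φ (-p.2) q :=
    Φ.continuous continuous_const continuous_id
  have hev2 := (hcont.tendsto (Φ p.2 p.1)).eventually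
    (by rw [← Φ.map_add, neg_add_cancel, Φ.map_zero_apply]; exact hev)
  filter_upwards [hev2] with q hq
  obtain ⟨s, hs, hsS, hsA⟩ := hq
  rw [← Φ.map_add] at hsS hsA
  -- The section point `Φ (s - p.2) q` returns to `q` after time `p.2 - s`, which is within `ε` of
  -- `p.2`.
  have hmem := hAB (show ((⟨_, hsS⟩ : S), p.2 - s) ∈ A ×ˢ B from
    ⟨hsub (show (⟨_, hsS⟩ : S) ∈ Subtype.val ⁻¹' A₁ from hsA), hB' (by
      rw [Metric.mem_ball, Real.dist_eq, sub_sub_cancel_left, abs_neg]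
      exact hs)⟩)
  have e : p.2 - s + (s + -p.2) = 0 := by ring
  simpa only [Set.mem_preimage, ← Φ.map_add, e, Φ.map_zero_apply] using hmem

/-- Every point lies on the arc from a point of the section to its first return. -/
theorem exists_eq_flow (h : IsGlobalPoincareSection Φ S) (p : X) :
    ∃ (x : S) (t : ℝ), t ∈ Set.Ico (0 : ℝ) 1 ∧ Φ (t * returnTime Φ S x) x = p := by
  have hcl : IsClosed {t : ℝ | 0 ≤ t ∧ Φ (-t) p ∈ S} :=
    isClosed_Ici.inter (h.isClosed.preimage (Φ.continuous continuous_neg continuous_const))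
  have hbdd : BddBelow {t : ℝ | 0 ≤ t ∧ Φ (-t) p ∈ S} := ⟨0, fun t ht => ht.1⟩
  have hne : {t : ℝ | 0 ≤ t ∧ Φ (-t) p ∈ S}.Nonempty := by
    obtain ⟨t, ht, htS⟩ := h.backward p
    exact ⟨-t, by linarith, by rwa [neg_neg]⟩
  -- The infimum is the time since the last visit to `S`. Admitting `t = 0` keeps the set closed
  -- without any gap argument and gives section points parameter zero.
  obtain ⟨h0, hS⟩ := hcl.csInf_mem hne hbdd
  set r := sInf {t : ℝ | 0 ≤ t ∧ Φ (-t) p ∈ S} with hr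
  have hT := h.returnTime_pos ⟨_, hS⟩
  refine ⟨⟨_, hS⟩, r / returnTime Φ S (Φ (-r) p), ⟨by positivity, ?_⟩, ?_⟩
  · rw [div_lt_one hT]
    by_contra! hle
    have hmem := (h.isLeast_returnTime hS).1.2
    rw [← Φ.map_add] at hmem
    have : r ≤ r - returnTime Φ S (Φ (-r) p) :=
      csInf_le hbdd ⟨by linarith, by rwa [neg_sub, sub_eq_add_neg]⟩
    linarith
  · rw [div_mul_cancel₀ _ hT.ne', ← Φ.map_add, add_neg_cancel, Φ.map_zero_apply]

/-- Flowing back along the shorter arc exhibits `y` on the orbit of `x` before the first return, so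
the two arc lengths agree. -/
theorem flow_mul_returnTime_inj (h : IsGlobalPoincareSection Φ S) {x y : S} {t s : ℝ}
    (ht : t ∈ Set.Ico (0 : ℝ) 1) (hs : s ∈ Set.Ico (0 : ℝ) 1)
    (e : Φ (t * returnTime Φ S x) x = Φ (s * returnTime Φ S y) y) : x = y ∧ t = s := by
  wlog hle : s * returnTime Φ S y ≤ t * returnTime Φ S x generalizing x y s t
  · exact (this hs ht e.symm (le_of_not_ge hle)).imp Eq.symm Eq.symm
  have hT := h.returnTime_pos x
  have e' : Φ (t * returnTime Φ S x - s * returnTime Φ S y) x = y := by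
    rw [sub_eq_neg_add, Φ.map_add, e, ← Φ.map_add, neg_add_cancel, Φ.map_zero_apply]
  have h0 : t * returnTime Φ S x - s * returnTime Φ S y = 0 := by
    by_contra hne
    have h1 := h.returnTime_le x (lt_of_le_of_ne (sub_nonneg.2 hle) (Ne.symm hne))
      (by rw [e']; exact y.2)
    have h2 : t * returnTime Φ S x < returnTime Φ S x := by nlinarith [ht.2]
    have h3 : 0 ≤ s * returnTime Φ S y := mul_nonneg hs.1 (h.returnTime_pos y).le
    linarith
  rw [h0, Φ.map_zero_apply] at e'
  have hxy := Subtype.ext e'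
  subst hxy
  exact ⟨rfl, mul_right_cancel₀ hT.ne' (sub_eq_zero.1 h0)⟩

end IsGlobalPoincareSection

end Sections

/-! ### The mapping torus as a quotient of `X × ℝ` -/

namespace MappingTorus

variable {X : Type u} [TopologicalSpace X] (f : X ≃ₜ X)

/-- The covering map `X × ℝ → X_f`, which sends `(x, r)` to `Σf([x, 0], r)`. -/
noncomputable def cover (p : X × ℝ) : MappingTorus f := mkFract f ((f ^ ⌊p.2⌋) p.1) p.2

theorem cover_eq_suspend (x : X) (r : ℝ) : cover f (x, r) = suspend f r (mk f x 0) := by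
  simp [suspend_mk, cover]

theorem suspend_cover (s : ℝ) (x : X) (r : ℝ) :
    suspend f s (cover f (x, r)) = cover f (x, s + r) := by
  rw [cover_eq_suspend, cover_eq_suspend, suspend_add]

theorem cover_add_int (x : X) (r : ℝ) (n : ℤ) :
    cover f (x, r + n) = cover f ((f ^ n) x, r) := by
  simp only [cover, mkFract, Int.floor_add_intCast, Int.fract_add_intCast, zpow_add,
    Homeomorph.mul_apply]

theorem cover_of_mem_Ico (x : X) {r : ℝ} (h : r ∈ Set.Ico (0 : ℝ) 1) :
    cover f (x, r) = mk f x ⟨r, h.1, h.2.le⟩ := by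
  have h0 : ⌊r⌋ = 0 := Int.floor_eq_zero_iff.2 h
  simp [cover, mkFract, h0, Int.fract_eq_self.2 h]

theorem cover_coe (x : X) (t : unitInterval) : cover f (x, t) = mk f x t := by
  rcases t.2.2.eq_or_lt with h | h
  · have ht : t = 1 := Subtype.ext h
    subst ht
    have := cover_add_int f x 0 1
    rw [zero_add, Int.cast_one] at this
    rw [Set.Icc.coe_one, this, cover_of_mem_Ico f _ ⟨le_rfl, one_pos⟩, mk_one]
    rfl
  · exact cover_of_mem_Ico f x ⟨t.2.1, h⟩

theorem exists_mk_eq (p : MappingTorus f) : ∃ x t, mk f x t = p := by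
  obtain ⟨⟨x, t⟩, h⟩ := Quot.exists_rep p
  exact ⟨x, t, h⟩

theorem cover_surjective : Function.Surjective (cover f) := by
  intro p
  obtain ⟨x, t, rfl⟩ := exists_mk_eq f p
  exact ⟨(x, t), cover_coe f x t⟩

/-- Every point is `[x, t]` with `0 ≤ t < 1`. -/
theorem exists_mk_eq_of_lt_one (p : MappingTorus f) :
    ∃ (x : X) (t : unitInterval), (t : ℝ) < 1 ∧ mk f x t = p := by
  obtain ⟨⟨x, r⟩, rfl⟩ := cover_surjective f p
  exact ⟨_, _, Int.fract_lt_one r, rfl⟩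

/-- The normal form replacing `(x, 1)` by `(f x, 0)` respects the gluing and fixes every pair with
parameter below one. -/
theorem mk_injective {x y : X} {t s : unitInterval} (ht : (t : ℝ) < 1) (hs : (s : ℝ) < 1)
    (h : mk f x t = mk f y s) : x = y ∧ t = s := by
  classical
  let F : MappingTorus f → X × unitInterval :=
    Quot.lift (fun p => if p.2 = 1 then (f p.1, 0) else p) <| by
      rintro _ _ ⟨z⟩
      simp
  have ht' : t ≠ 1 := fun e => by simp [e] at ht
  have hs' : s ≠ 1 := fun e => by simp [e] at hs
  have e : F (mk f x t) = F (mk f y s) := by rw [h]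
  simpa [F, mk, ht', hs'] using e

theorem zpow_apply_eq_iff (n : ℤ) (x y : X) : (f ^ n) x = y ↔ x = (f ^ (-n)) y := by
  constructor
  · rintro rfl
    rw [← Homeomorph.mul_apply, ← zpow_add, neg_add_cancel]
    rfl
  · rintro rfl
    rw [← Homeomorph.mul_apply, ← zpow_add, add_neg_cancel]
    rfl

theorem cover_eq_cover_iff {p q : X × ℝ} :
    cover f p = cover f q ↔ ∃ n : ℤ, (f ^ n) p.1 = q.1 ∧ p.2 = q.2 + n := by
  constructor
  · intro h
    obtain ⟨h1, h2⟩ := mk_injective f (Int.fract_lt_one _) (Int.fract_lt_one _) h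
    refine ⟨⌊p.2⌋ - ⌊q.2⌋, ?_, ?_⟩
    · rw [sub_eq_neg_add, zpow_add, Homeomorph.mul_apply, h1, ← Homeomorph.mul_apply, ← zpow_add,
        neg_add_cancel]
      rfl
    · have h3 : Int.fract p.2 = Int.fract q.2 := congrArg Subtype.val h2
      have := Int.floor_add_fract p.2
      have := Int.floor_add_fract q.2
      push_cast
      linarith
  · obtain ⟨x, r⟩ := p
    obtain ⟨y, s⟩ := q
    rintro ⟨n, rfl, h⟩
    rw [show r = s + n from h, cover_add_int]

theorem isQuotientMap_mk : IsQuotientMap fun p : X × unitInterval => mk f p.1 p.2 :=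
  isQuotientMap_quot_mk

theorem continuous_mk : Continuous fun p : X × unitInterval => mk f p.1 p.2 :=
  (isQuotientMap_mk f).continuous

theorem continuous_zpow (n : ℤ) : Continuous fun x => (f ^ n) x := (f ^ n).continuous

/-- On each closed strip `[n, n + 1]` the map is `[f^n x, r - n]`, right endpoint included because
of the gluing. Near any point two adjacent strips suffice. -/
theorem continuous_cover : Continuous (cover f) := by
  have hn : ∀ n : ℤ, ContinuousOn (cover f) (Set.univ ×ˢ Set.Icc (n : ℝ) (n + 1)) := by
    intro n
    have hc : Continuous fun p : X × ℝ =>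
        mk f ((f ^ n) p.1) (Set.projIcc 0 1 zero_le_one (p.2 - n)) :=
      (continuous_mk f).comp (f := fun p : X × ℝ =>
          ((f ^ n) p.1, Set.projIcc (0 : ℝ) 1 zero_le_one (p.2 - n)))
        (((continuous_zpow f n).comp continuous_fst).prodMk
          (continuous_projIcc.comp (by fun_prop)))
    refine hc.continuousOn.congr fun p hp => ?_
    obtain ⟨-, h1, h2⟩ := hp
    beta_reduce
    rw [← cover_coe, Set.projIcc_of_mem zero_le_one ⟨by linarith, by linarith⟩, ← cover_add_int,
      sub_add_cancel]
  refine continuous_iff_continuousAt.2 fun p => ?_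
  have hu := (hn (⌊p.2⌋ - 1)).union_of_isClosed (hn ⌊p.2⌋) (isClosed_univ.prod isClosed_Icc)
    (isClosed_univ.prod isClosed_Icc)
  refine hu.continuousAt ?_
  have hI : Set.Ioo ((⌊p.2⌋ : ℝ) - 1) (⌊p.2⌋ + 1) ∈ 𝓝 p.2 :=
    Ioo_mem_nhds (by linarith [Int.floor_le p.2]) (Int.lt_floor_add_one p.2)
  filter_upwards [continuous_snd.continuousAt.preimage_mem_nhds hI] with q hq
  rcases le_total (⌊p.2⌋ : ℝ) q.2 with h | h
  · exact Or.inr ⟨trivial, h, hq.2.le⟩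
  · refine Or.inl ⟨trivial, ?_, ?_⟩
    · push_cast
      exact hq.1.le
    · push_cast
      linarith

/-- The preimage in `X × [0, 1]` of the image of `W` is the union over `n` of preimages of `W` under
deck translations. -/
theorem isOpenMap_cover : IsOpenMap (cover f) := by
  intro W hW
  rw [← (isQuotientMap_mk f).isOpen_preimage]
  have e : (fun p : X × unitInterval => mk f p.1 p.2) ⁻¹' (cover f '' W) =
      ⋃ n : ℤ, (fun p : X × unitInterval => ((f ^ (-n)) p.1, (p.2 : ℝ) + n)) ⁻¹' W := by
    ext ⟨y, t⟩
    simp only [← cover_coe, Set.mem_image, Set.mem_iUnion, Set.mem_preimage, cover_eq_cover_iff,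
      zpow_apply_eq_iff]
    constructor
    · rintro ⟨⟨x, r⟩, hW, n, rfl, rfl⟩
      exact ⟨n, hW⟩
    · rintro ⟨n, hn⟩
      exact ⟨_, hn, n, rfl, rfl⟩
  rw [e]
  refine isOpen_iUnion fun n => hW.preimage ?_
  exact ((continuous_zpow f _).comp continuous_fst).prodMk
    ((continuous_subtype_val.comp continuous_snd).add continuous_const)

theorem isOpenQuotientMap_cover : IsOpenQuotientMap (cover f) :=
  ⟨cover_surjective f, continuous_cover f, isOpenMap_cover f⟩

/-- Open quotient maps are stable under products, so continuity may be tested upstairs, where the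
flow is a translation. -/
theorem continuous_suspend : Continuous fun q : ℝ × MappingTorus f => suspend f q.1 q.2 := by
  rw [← ((IsOpenQuotientMap.id (X := ℝ)).prodMap (isOpenQuotientMap_cover f)).continuous_comp_iff]
  have e : (fun q : ℝ × MappingTorus f => suspend f q.1 q.2) ∘ Prod.map id (cover f) =
      fun q : ℝ × (X × ℝ) => cover f (q.2.1, q.1 + q.2.2) := by
    funext q
    exact suspend_cover f q.1 q.2.1 q.2.2
  rw [e]
  exact (continuous_cover f).comp (by fun_prop)

instance instSecondCountable [SecondCountableTopology X] :
    SecondCountableTopology (MappingTorus f) :=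
  (isOpenQuotientMap_cover f).isQuotientMap.secondCountableTopology (isOpenMap_cover f)

/-- For an open quotient it suffices that the equivalence relation is closed. It is a union of
closed graphs indexed by `n`, locally finite because `n` is the difference of the real coordinates.
-/
instance instT2Space [T2Space X] : T2Space (MappingTorus f) := by
  rw [t2Space_iff_of_isOpenQuotientMap (isOpenQuotientMap_cover f)]
  have e : {q : (X × ℝ) × X × ℝ | cover f q.1 = cover f q.2} =
      ⋃ n : ℤ, {q | (f ^ n) q.1.1 = q.2.1 ∧ q.1.2 = q.2.2 + (n : ℝ)} := by
    ext q
    simp [cover_eq_cover_iff]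
  rw [e]
  refine LocallyFinite.isClosed_iUnion ?_ fun n => ?_
  · intro q
    have hc : Continuous fun q : (X × ℝ) × X × ℝ => q.1.2 - q.2.2 := by fun_prop
    refine ⟨_, hc.continuousAt.preimage_mem_nhds (Metric.ball_mem_nhds _ one_pos),
      (Set.finite_Icc ⌊q.1.2 - q.2.2 - 1⌋ ⌈q.1.2 - q.2.2 + 1⌉).subset ?_⟩
    rintro n ⟨q', ⟨-, h1⟩, h2⟩
    rw [Set.mem_preimage, h1, add_sub_cancel_left, Metric.mem_ball, Real.dist_eq, abs_lt] at h2
    constructor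
    · exact Int.cast_le.1 ((Int.floor_le _).trans (by linarith : q.1.2 - q.2.2 - 1 ≤ (n : ℝ)))
    · exact Int.cast_le.1 ((by linarith : (n : ℝ) ≤ q.1.2 - q.2.2 + 1).trans (Int.le_ceil _))
  · exact (isClosed_eq ((continuous_zpow f n).comp (by fun_prop)) (by fun_prop)).inter
      (isClosed_eq (by fun_prop) (by fun_prop))

theorem cover_mem_zeroSection (x : X) (r : ℝ) :
    cover f (x, r) ∈ zeroSection f ↔ ∃ n : ℤ, r = n := by
  rw [cover, mkFract, mk_mem_zeroSection]
  simp only [Subtype.ext_iff, Set.Icc.coe_zero, Set.Icc.coe_one, (Int.fract_lt_one r).ne, or_false,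
    Int.fract_eq_zero_iff, Set.mem_range, eq_comm]

theorem isClosed_zeroSection : IsClosed (zeroSection f) := by
  rw [← (isQuotientMap_mk f).isClosed_preimage]
  have e : (fun p : X × unitInterval => mk f p.1 p.2) ⁻¹' zeroSection f =
      {p : X × unitInterval | p.2 = 0} ∪ {p | p.2 = 1} := by
    ext ⟨x, t⟩
    exact mk_mem_zeroSection f x t
  rw [e]
  exact (isClosed_eq continuous_snd continuous_const).union
    (isClosed_eq continuous_snd continuous_const)

theorem injOn_cover (r : ℝ) :
    Set.InjOn (cover f) (Set.univ ×ˢ Set.Ioo (r - 1 / 2) (r + 1 / 2)) := by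
  rintro ⟨x, a⟩ ⟨-, ha⟩ ⟨y, b⟩ ⟨-, hb⟩ h
  obtain ⟨n, h1, h2⟩ := (cover_eq_cover_iff f).1 h
  simp only [Set.mem_Ioo] at h1 h2 ha hb
  have hn : n = 0 := by
    have h3 : (n : ℝ) < 1 := by linarith
    have h4 : (-1 : ℝ) < n := by linarith
    norm_cast at h3 h4
    omega
  subst hn
  simp only [zpow_zero, Homeomorph.one_apply, Int.cast_zero, add_zero] at h1 h2
  rw [h1, h2]

/-- The covering map restricted to `X × (r - 1/2, r + 1/2)`. -/
noncomputable def coverChart [Nonempty X] (r : ℝ) :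
    OpenPartialHomeomorph (X × ℝ) (MappingTorus f) :=
  OpenPartialHomeomorph.ofContinuousOpen ((injOn_cover f r).toPartialEquiv _ _)
    (continuous_cover f).continuousOn (isOpenMap_cover f) (isOpen_univ.prod isOpen_Ioo)

/-- The chart `[x, r] ↦ (e x, 3 r)` of the mapping torus induced by a chart `e` of `X`. -/
noncomputable def chart [Nonempty X] {n : ℕ}
    (e : OpenPartialHomeomorph X (EuclideanSpace ℝ (Fin n))) (r : ℝ) :
    OpenPartialHomeomorph (MappingTorus f) (EuclideanSpace ℝ (Fin (n + 1))) :=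
  -- For `r = 0` and `e` onto, the factor 3 stretches the strip to `(-3/2, 3/2)`, so the image
  -- contains the unit ball, while times up to `1/4` still land inside that ball.
  ((coverChart f r).symm.trans (e.prod
    (Homeomorph.mulLeft₀ (3 : ℝ) three_ne_zero).toOpenPartialHomeomorph)).trans
    (euclideanSnoc n).toOpenPartialHomeomorph

section Chart

variable [Nonempty X] {n : ℕ} (e : OpenPartialHomeomorph X (EuclideanSpace ℝ (Fin n))) (r : ℝ)

theorem coverChart_symm_cover {p : X × ℝ} (hp : p.2 ∈ Set.Ioo (r - 1 / 2) (r + 1 / 2)) :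
    (coverChart f r).symm (cover f p) = p :=
  (coverChart f r).left_inv (x := p) ⟨trivial, hp⟩

theorem cover_mem_chart_source {p : X × ℝ} (hp : p.2 ∈ Set.Ioo (r - 1 / 2) (r + 1 / 2))
    (he : p.1 ∈ e.source) : cover f p ∈ (chart f e r).source := by
  have h1 : cover f p ∈ (coverChart f r).target :=
    (coverChart f r).map_source (x := p) ⟨trivial, hp⟩
  simp [chart, coverChart_symm_cover f r hp, h1, he]

theorem exists_of_mem_chart_source {y : MappingTorus f} (hy : y ∈ (chart f e r).source) :
    ∃ p : X × ℝ, p.2 ∈ Set.Ioo (r - 1 / 2) (r + 1 / 2) ∧ p.1 ∈ e.source ∧ cover f p = y := by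
  simp only [chart, OpenPartialHomeomorph.trans_source, Set.mem_inter_iff] at hy
  obtain ⟨⟨h1, h2⟩, -⟩ := hy
  have h3 := (coverChart f r).map_target h1
  exact ⟨_, h3.2, h2.1, (coverChart f r).right_inv h1⟩

theorem chart_cover {p : X × ℝ} (hp : p.2 ∈ Set.Ioo (r - 1 / 2) (r + 1 / 2)) :
    chart f e r (cover f p) = euclideanSnoc n (e p.1, 3 * p.2) := by
  simp [chart, coverChart_symm_cover f r hp]

theorem mem_chart_target {v : EuclideanSpace ℝ (Fin (n + 1))} (he : e.target = Set.univ)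
    (hv : v (Fin.last n) / 3 ∈ Set.Ioo (r - 1 / 2) (r + 1 / 2)) :
    v ∈ (chart f e r).target := by
  obtain ⟨⟨w, a⟩, rfl⟩ := (euclideanSnoc n).surjective v
  rw [euclideanSnoc_last] at hv
  have hw : w ∈ e.target := by rw [he]; trivial
  have e1 : chart f e r (cover f (e.symm w, a / 3)) = euclideanSnoc n (w, a) := by
    rw [chart_cover f e r (p := (e.symm w, a / 3)) hv]
    simp only [e.right_inv hw, mul_div_cancel₀ a (three_ne_zero' ℝ)]
  rw [← e1]
  exact (chart f e r).map_source
    (cover_mem_chart_source f e r (p := (e.symm w, a / 3)) hv (e.map_target hw))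

end Chart

end MappingTorus

/-- Around every point of a manifold there is a chart onto `ℝⁿ` that sends the point to `0`. -/
theorem exists_centered_chart {X : Type u} [TopologicalSpace X] {n : ℕ}
    [ChartedSpace (EuclideanSpace ℝ (Fin n)) X] (x : X) :
    ∃ e : OpenPartialHomeomorph X (EuclideanSpace ℝ (Fin n)),
      x ∈ e.source ∧ e x = 0 ∧ e.target = Set.univ := by
  set c := chartAt (EuclideanSpace ℝ (Fin n)) x
  have hx : x ∈ c.source := mem_chart_source _ x
  obtain ⟨ρ, hρ, hball⟩ := Metric.isOpen_iff.1 c.open_target _ (c.map_source hx)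
  set b := OpenPartialHomeomorph.univBall (c x) ρ
  have hb : b.target = Metric.ball (c x) ρ := OpenPartialHomeomorph.univBall_target _ hρ
  have hb' : b.source = Set.univ := OpenPartialHomeomorph.univBall_source _ _
  have h0 : b 0 = c x := OpenPartialHomeomorph.univBall_apply_zero _ _
  have hcx : b.symm (c x) = 0 := by rw [← h0, b.left_inv (by rw [hb']; trivial)]
  refine ⟨c.trans b.symm, ?_, ?_, ?_⟩
  · rw [OpenPartialHomeomorph.trans_source]
    refine ⟨hx, ?_⟩
    rw [Set.mem_preimage, OpenPartialHomeomorph.symm_source, hb]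
    exact Metric.mem_ball_self hρ
  · simpa using hcx
  · rw [OpenPartialHomeomorph.trans_target, OpenPartialHomeomorph.symm_target, hb',
      Set.univ_inter, Set.eq_univ_iff_forall]
    intro v
    refine hball ?_
    rw [← hb]
    exact b.map_source (by rw [hb']; trivial)

/-! ### The zero section is a global Poincaré section -/

namespace MappingTorus

variable {X : Type u} [TopologicalSpace X] (f : X ≃ₜ X)

theorem isTopManifoldOfDim {n : ℕ} (h : IsTopManifoldOfDim n X) :
    IsTopManifoldOfDim (n + 1) (MappingTorus f) := by
  obtain ⟨hT, hs, ⟨c⟩⟩ := h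
  refine ⟨inferInstance, inferInstance, nonempty_chartedSpace fun p => ?_⟩
  obtain ⟨⟨x, r⟩, rfl⟩ := cover_surjective f p
  have : Nonempty X := ⟨x⟩
  exact ⟨chart f (chartAt _ x) r, cover_mem_chart_source f _ r (p := (x, r))
    ⟨by linarith, by linarith⟩ (mem_chart_source _ x)⟩

theorem mem_zeroSection_iff_of_mem_chart_source [Nonempty X] {n : ℕ}
    (e : OpenPartialHomeomorph X (EuclideanSpace ℝ (Fin n))) {y : MappingTorus f}
    (hy : y ∈ (chart f e 0).source) :
    y ∈ zeroSection f ↔ chart f e 0 y (Fin.last n) = 0 := by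
  obtain ⟨p, hp, -, rfl⟩ := exists_of_mem_chart_source f e 0 hy
  rw [chart_cover f e 0 hp, euclideanSnoc_last, cover_mem_zeroSection]
  simp only [mul_eq_zero, three_ne_zero, false_or]
  constructor
  · rintro ⟨n, hn⟩
    simp only [hn, Set.mem_Ioo] at hp
    have h3 : (n : ℝ) < 1 := by linarith
    have h4 : (-1 : ℝ) < n := by linarith
    norm_cast at h3 h4
    rw [hn]
    exact_mod_cast (by omega : n = 0)
  · intro h
    exact ⟨0, by simpa using h⟩

theorem suspensionFlow_mk_zero (x : X) (t : ℝ) :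
    suspensionFlow f (continuous_suspend f) t (mk f x 0) = cover f (x, t) :=
  (cover_eq_suspend f x t).symm

theorem isLocallyFlatHypersurface_zeroSection {n : ℕ} (h : IsTopManifoldOfDim n X) :
    IsLocallyFlatHypersurface n (zeroSection f) := by
  obtain ⟨-, -, ⟨c⟩⟩ := h
  rintro _ ⟨x, rfl⟩
  have : Nonempty X := ⟨x⟩
  refine ⟨chart f (chartAt _ x) 0, ?_, fun y hy =>
    mem_zeroSection_iff_of_mem_chart_source f _ hy⟩
  have := cover_mem_chart_source f (chartAt (EuclideanSpace ℝ (Fin n)) x) 0 (p := (x, 0))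
    ⟨by norm_num, by norm_num⟩ (mem_chart_source _ x)
  rwa [cover_of_mem_Ico f x ⟨le_rfl, one_pos⟩] at this

theorem isTopTransversal_zeroSection {n : ℕ} (h : IsTopManifoldOfDim n X) :
    IsTopTransversal (suspensionFlow f (continuous_suspend f)) (zeroSection f) := by
  refine ⟨n, isTopManifoldOfDim f h, isLocallyFlatHypersurface_zeroSection f h,
    ⟨fun _ => 1 / 4, fun _ => -1 / 4, ?_⟩, fun y a b => (isCompact_Icc.image
      ((suspensionFlow f _).continuous continuous_id continuous_const)).inter_right
      (isClosed_zeroSection f)⟩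
  rintro _ ⟨x, rfl⟩
  refine ⟨by norm_num, by norm_num, ?_⟩
  have : Nonempty X := ⟨x⟩
  obtain ⟨-, -, ⟨c⟩⟩ := h
  obtain ⟨e, hxe, hx0, het⟩ := exists_centered_chart (n := n) x
  set φ := (chart f e 0).trans (OpenPartialHomeomorph.ofSet (Metric.ball 0 1) Metric.isOpen_ball)
    with hφ
  have hφ_apply : ∀ y, φ y = chart f e 0 y := fun y => by simp [hφ]
  have hsource : ∀ {y}, y ∈ φ.source ↔ y ∈ (chart f e 0).source ∧ ‖chart f e 0 y‖ < 1 := by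
    intro y
    simp [hφ]
  have hS : ∀ y ∈ φ.source, y ∈ zeroSection f ↔ φ y (Fin.last n) = 0 := by
    intro y hy
    rw [hφ_apply]
    exact mem_zeroSection_iff_of_mem_chart_source f e (hsource.1 hy).1
  have hmem : ∀ t ∈ Set.Icc (-1 / 4 : ℝ) (1 / 4), cover f (x, t) ∈ φ.source ∧
      φ (cover f (x, t)) (Fin.last n) = 3 * t := by
    intro t ht
    have hI : t ∈ Set.Ioo ((0 : ℝ) - 1 / 2) (0 + 1 / 2) :=
      ⟨by linarith [ht.1], by linarith [ht.2]⟩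
    rw [hφ_apply, hsource, chart_cover f e 0 (p := (x, t)) hI, euclideanSnoc_last]
    refine ⟨⟨cover_mem_chart_source f e 0 hI hxe, ?_⟩, rfl⟩
    rw [← abs_norm, ← sq_lt_one_iff_abs_lt_one, norm_sq_euclideanSnoc]
    simp only [hx0, norm_zero]
    nlinarith [ht.1, ht.2]
  have hoff : ∀ t ∈ Set.Icc (-1 / 4 : ℝ) (1 / 4), t ≠ 0 →
      cover f (x, t) ∈ φ.source \ zeroSection f := by
    intro t ht h0
    refine ⟨(hmem t ht).1, fun hz => h0 ?_⟩
    have := (hS _ (hmem t ht).1).1 hz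
    rw [(hmem t ht).2] at this
    linarith
  have hcov : Continuous fun t : ℝ => cover f (x, t) :=
    (continuous_cover f).comp (by fun_prop)
  have h00 : mk f x 0 = cover f (x, 0) := (cover_of_mem_Ico f x ⟨le_rfl, one_pos⟩).symm
  have hx0S : mk f x 0 ∈ zeroSection f := ⟨x, rfl⟩
  refine ⟨φ, ?_, ?_, hS, ?_, ?_, φ.source, ?_, subset_rfl, 1 / 8, by norm_num,
    fun y _ => ⟨by norm_num, by norm_num⟩⟩
  · beta_reduce
    rw [h00]
    exact (hmem 0 ⟨by norm_num, by norm_num⟩).1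
  · rw [hφ, OpenPartialHomeomorph.trans_target]
    refine Set.inter_eq_left.2 fun v hv => mem_chart_target f e 0 het ?_
    have h1 := norm_sq_euclideanSnoc n ((euclideanSnoc n).symm v)
    rw [Homeomorph.apply_symm_apply, euclideanSnoc_symm_snd] at h1
    have h2 : ‖v‖ < 1 := by simpa using hv
    have h3 : |v (Fin.last n)| < 1 := by
      rw [← sq_lt_one_iff_abs_lt_one]
      nlinarith [norm_nonneg v, sq_nonneg ‖((euclideanSnoc n).symm v).1‖]
    rw [abs_lt] at h3
    constructor <;> linarith
  · have ha := hoff (-1 / 4) ⟨by norm_num, by norm_num⟩ (by norm_num)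
    have hb := hoff (1 / 4) ⟨by norm_num, by norm_num⟩ (by norm_num)
    simp only [suspensionFlow_mk_zero]
    refine ⟨_, ha, _, hb, fun heq => ?_, fun t ht => ?_, fun t ht => ?_⟩
    -- The last coordinate takes the values `-3/4` and `3/4` at the two endpoints. On a common
    -- component it would vanish somewhere, which happens only on the section.
    · have hpre : _root_.IsPreconnected ((fun y => φ y (Fin.last n)) ''
          connectedComponentIn (φ.source \ zeroSection f) (cover f (x, -1 / 4))) := by
        refine isPreconnected_connectedComponentIn.image _ ?_
        have : Continuous fun v : EuclideanSpace ℝ (Fin (n + 1)) => v (Fin.last n) := by fun_prop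
        exact this.comp_continuousOn (φ.continuousOn.mono
          fun y hy => (connectedComponentIn_subset _ _ hy).1)
      have h1 := Set.mem_image_of_mem (fun y => φ y (Fin.last n)) (mem_connectedComponentIn ha)
      have h2 := Set.mem_image_of_mem (fun y => φ y (Fin.last n)) (mem_connectedComponentIn hb)
      rw [← heq] at h2
      simp only [(hmem (-1 / 4) ⟨by norm_num, by norm_num⟩).2,
        (hmem (1 / 4) ⟨by norm_num, by norm_num⟩).2] at h1 h2
      obtain ⟨y, hy, hy0⟩ := hpre.Icc_subset h1 h2 (show (0 : ℝ) ∈ _ by norm_num)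
      have hy' := connectedComponentIn_subset _ _ hy
      exact hy'.2 ((hS y hy'.1).2 hy0)
    · refine (isPreconnected_Ico.image _ hcov.continuousOn).subset_connectedComponentIn
        (Set.mem_image_of_mem _ (Set.left_mem_Ico.2 (by norm_num))) ?_ (Set.mem_image_of_mem _ ht)
      rintro _ ⟨s, hs, rfl⟩
      exact hoff s ⟨hs.1, by linarith [hs.2]⟩ hs.2.ne
    · refine (isPreconnected_Ioc.image _ hcov.continuousOn).subset_connectedComponentIn
        (Set.mem_image_of_mem _ (Set.right_mem_Ioc.2 (by norm_num))) ?_ (Set.mem_image_of_mem _ ht)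
      rintro _ ⟨s, hs, rfl⟩
      exact hoff s ⟨by linarith [hs.1], hs.2⟩ hs.1.ne'
  · simp only [suspensionFlow_mk_zero]
    refine Set.eq_singleton_iff_unique_mem.2 ⟨⟨⟨0, ⟨by norm_num, by norm_num⟩, h00.symm⟩, hx0S⟩, ?_⟩
    rintro _ ⟨⟨t, ht, rfl⟩, hz⟩
    by_cases h0 : t = 0
    · rw [h0, h00]
    · exact ((hoff t ht h0).2 hz).elim
  · refine φ.open_source.mem_nhds ?_
    beta_reduce
    rw [h00]
    exact (hmem 0 ⟨by norm_num, by norm_num⟩).1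

theorem isGlobalPoincareSection_zeroSection (h : IsTopManifold X) :
    IsGlobalPoincareSection (suspensionFlow f (continuous_suspend f)) (zeroSection f) := by
  obtain ⟨n, hn⟩ := h
  have hit : ∀ (x : X) (r : ℝ) (k : ℤ),
      suspensionFlow f (continuous_suspend f) (k - r) (cover f (x, r)) ∈ zeroSection f := by
    intro x r k
    change suspend f (k - r) (cover f (x, r)) ∈ _
    rw [suspend_cover, sub_add_cancel, cover_mem_zeroSection]
    exact ⟨k, rfl⟩
  refine ⟨isClosed_zeroSection f, isTopTransversal_zeroSection f hn, fun p => ?_, fun p => ?_⟩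
  · obtain ⟨⟨x, r⟩, rfl⟩ := cover_surjective f p
    exact ⟨_, sub_pos.2 (by exact_mod_cast Int.lt_floor_add_one r), hit x r (⌊r⌋ + 1)⟩
  · obtain ⟨⟨x, r⟩, rfl⟩ := cover_surjective f p
    exact ⟨_, sub_neg.2 (by push_cast; linarith [Int.ceil_lt_add_one r]), hit x r (⌈r⌉ - 1)⟩

end MappingTorus

theorem suspensionWellDefined : SuspensionWellDefined.{u} := fun M =>
  ⟨M.manifold.imp' _ fun _ h => MappingTorus.isTopManifoldOfDim M.map h,
    MappingTorus.continuous_suspend M.map,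
    MappingTorus.isGlobalPoincareSection_zeroSection M.map M.manifold⟩

/-! ### The homeomorphism from the mapping torus of the Poincaré map -/

section Sections

variable {X : Type u} [TopologicalSpace X] {Φ : Flow ℝ X} {S : Set X}

namespace IsGlobalPoincareSection

/-- The Poincaré map as a self-homeomorphism of the section. -/
noncomputable def poincareHomeomorph (h : IsGlobalPoincareSection Φ S) : S ≃ₜ S :=
  ⟨poincareMap h, h.continuous_poincareMap, h.continuous_poincareMap_symm⟩

theorem poincareHomeomorph_zpow_apply (h : IsGlobalPoincareSection Φ S) (n : ℤ) (x : S) :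
    (h.poincareHomeomorph ^ n) x = (poincareMap h ^ n) x := by
  induction n generalizing x with
  | zero => rfl
  | succ n ih =>
    rw [zpow_add_one, zpow_add_one, Homeomorph.mul_apply, ih]
    rfl
  | pred n ih =>
    rw [zpow_sub_one, zpow_sub_one, Homeomorph.mul_apply, ih]
    rfl

/-- The map `[x, t] ↦ Φ(x, t T_Φ(x))` from the mapping torus of the Poincaré map. -/
noncomputable def torusMap (h : IsGlobalPoincareSection Φ S) :
    MappingTorus h.poincareHomeomorph → X :=
  Quot.lift (fun p => Φ (p.2 * returnTime Φ S p.1) p.1) <| by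
    rintro _ _ ⟨x⟩
    simp only [Set.Icc.coe_one, one_mul, Set.Icc.coe_zero, zero_mul, Φ.map_zero_apply]
    rfl

/-- The time change `([x, t], s) ↦ ∫₀^{s+t} R_Φ(x) - t T_Φ(x)`. -/
noncomputable def torusTime (h : IsGlobalPoincareSection Φ S) :
    MappingTorus h.poincareHomeomorph → ℝ → ℝ :=
  Quot.lift (fun p s => rateTime h p.1 p.2 s) <| by
    rintro _ _ ⟨x⟩
    funext s
    simp only [rateTime_eq, Set.Icc.coe_one, cumTime_add_one, Set.Icc.coe_zero, zero_mul, one_mul,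
      add_zero, sub_zero, add_sub_cancel_left]
    rfl

theorem torusMap_mk (h : IsGlobalPoincareSection Φ S) (x : S) (t : unitInterval) :
    h.torusMap (MappingTorus.mk _ x t) = Φ (t * returnTime Φ S x) x := rfl

theorem torusMap_mk_zero (h : IsGlobalPoincareSection Φ S) (x : S) :
    h.torusMap (MappingTorus.mk _ x 0) = x := by
  rw [torusMap_mk, Set.Icc.coe_zero, zero_mul, Φ.map_zero_apply]

/-- The formula upstairs needs no case split at integers; compatibility with the flows and openness
both follow from it. -/
theorem torusMap_cover (h : IsGlobalPoincareSection Φ S) (x : S) (r : ℝ) :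
    h.torusMap (MappingTorus.cover _ (x, r)) = Φ (h.cumTime x r) x := by
  have e := h.flow_cumTime_add_int x (Int.fract r) ⌊r⌋
  rw [Int.fract_add_floor, h.cumTime_of_mem _ ⟨Int.fract_nonneg r, (Int.fract_lt_one r).le⟩] at e
  rw [e, ← poincareHomeomorph_zpow_apply]
  rfl

theorem torusTime_cover (h : IsGlobalPoincareSection Φ S) (x : S) (r s : ℝ) :
    h.torusTime (MappingTorus.cover _ (x, r)) s = h.cumTime x (s + r) - h.cumTime x r := by
  have e1 := h.cumTime_add_int x (Int.fract r) ⌊r⌋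
  have e2 := h.cumTime_add_int x (s + Int.fract r) ⌊r⌋
  rw [Int.fract_add_floor, h.cumTime_of_mem _ ⟨Int.fract_nonneg r, (Int.fract_lt_one r).le⟩] at e1
  rw [add_assoc, Int.fract_add_floor] at e2
  rw [e1, e2, add_sub_add_left_eq_sub, ← poincareHomeomorph_zpow_apply]
  rfl

theorem torusTime_suspend_mk_zero (h : IsGlobalPoincareSection Φ S) (x : S) {t : ℝ}
    (ht : t ∈ Set.Icc (0 : ℝ) 1) (s : ℝ) :
    h.torusTime (MappingTorus.suspend _ t (MappingTorus.mk _ x 0)) s = rateTime h x t s := by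
  rw [← MappingTorus.cover_eq_suspend, torusTime_cover, rateTime_eq, h.cumTime_of_mem x ht]

theorem strictMono_torusTime (h : IsGlobalPoincareSection Φ S)
    (p : MappingTorus h.poincareHomeomorph) : StrictMono (h.torusTime p) := by
  obtain ⟨⟨x, r⟩, rfl⟩ := MappingTorus.cover_surjective _ p
  intro a b hab
  rw [torusTime_cover, torusTime_cover]
  exact sub_lt_sub_right (h.strictMono_cumTime x (add_lt_add_left hab r)) _

theorem surjective_torusTime (h : IsGlobalPoincareSection Φ S)
    (p : MappingTorus h.poincareHomeomorph) : Function.Surjective (h.torusTime p) := by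
  obtain ⟨⟨x, r⟩, rfl⟩ := MappingTorus.cover_surjective _ p
  intro v
  obtain ⟨w, hw⟩ := h.surjective_cumTime x (v + h.cumTime x r)
  exact ⟨w - r, by rw [torusTime_cover, sub_add_cancel, hw, add_sub_cancel_right]⟩

theorem isHomeomorph_torusTime (h : IsGlobalPoincareSection Φ S)
    (p : MappingTorus h.poincareHomeomorph) : IsHomeomorph (h.torusTime p) :=
  ((h.strictMono_torusTime p).orderIsoOfSurjective _
    (h.surjective_torusTime p)).toHomeomorph.isHomeomorph

theorem torusMap_suspend (h : IsGlobalPoincareSection Φ S)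
    (p : MappingTorus h.poincareHomeomorph) (s : ℝ) :
    h.torusMap (MappingTorus.suspend _ s p) = Φ (h.torusTime p s) (h.torusMap p) := by
  obtain ⟨⟨x, r⟩, rfl⟩ := MappingTorus.cover_surjective _ p
  rw [MappingTorus.suspend_cover, torusMap_cover, torusMap_cover, torusTime_cover, ← Φ.map_add,
    sub_add_cancel]

theorem torusMap_mem_iff (h : IsGlobalPoincareSection Φ S)
    (p : MappingTorus h.poincareHomeomorph) :
    h.torusMap p ∈ S ↔ p ∈ MappingTorus.zeroSection h.poincareHomeomorph := by
  obtain ⟨x, t, ht, rfl⟩ := MappingTorus.exists_mk_eq_of_lt_one _ p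
  constructor
  · intro hS
    have h0 : t = 0 := by
      by_contra hne
      have ht0 : 0 < (t : ℝ) := unitInterval.pos_iff_ne_zero.2 hne
      have hT := h.returnTime_pos x
      have := h.returnTime_le x (mul_pos ht0 hT) hS
      nlinarith
    exact ⟨x, by rw [h0]⟩
  · rintro ⟨y, hy⟩
    rw [← hy, torusMap_mk_zero]
    exact y.2

/-- Bijectivity is the unique decomposition into half-open return arcs. Openness is tested upstairs,
where the map is `isOpenMap_prod_cumTime` followed by `isOpenMap_flow`. -/
theorem isHomeomorph_torusMap (h : IsGlobalPoincareSection Φ S) : IsHomeomorph h.torusMap := by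
  refine ⟨?_, ?_, ?_, ?_⟩
  · rw [(MappingTorus.isQuotientMap_mk _).continuous_iff]
    exact Φ.continuous ((continuous_subtype_val.comp continuous_snd).mul
      (h.continuous_returnTime.comp continuous_fst)) (continuous_subtype_val.comp continuous_fst)
  · rw [(MappingTorus.isOpenQuotientMap_cover _).isOpenMap_iff]
    have e : h.torusMap ∘ MappingTorus.cover _ =
        (fun p : S × ℝ => Φ p.2 p.1) ∘ fun p : S × ℝ => (p.1, h.cumTime p.1 p.2) := by
      funext p
      exact h.torusMap_cover p.1 p.2
    rw [e]
    exact h.isOpenMap_flow.comp h.isOpenMap_prod_cumTime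
  · intro p q hpq
    obtain ⟨x, t, ht, rfl⟩ := MappingTorus.exists_mk_eq_of_lt_one _ p
    obtain ⟨y, s, hs, rfl⟩ := MappingTorus.exists_mk_eq_of_lt_one _ q
    obtain ⟨rfl, hts⟩ := h.flow_mul_returnTime_inj ⟨t.2.1, ht⟩ ⟨s.2.1, hs⟩ hpq
    rw [Subtype.ext hts]
  · intro p
    obtain ⟨x, t, ht, rfl⟩ := h.exists_eq_flow p
    exact ⟨MappingTorus.mk _ x ⟨t, ht.1, ht.2.le⟩, rfl⟩

end IsGlobalPoincareSection

end Sections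

/-! ### Isomorphisms and rigidity of morphisms -/

namespace MapDS

variable {M N : MapDS.{u}}

theorem isIso_of_isHomeomorph (f : M ⟶ N) (hf : IsHomeomorph (Hom.toFun f)) : IsIso f := by
  let e := hf.homeomorph
  have he : ∀ x, e x = Hom.toFun f x := fun _ => rfl
  let g : Hom N M :=
    { toFun := e.symm
      continuous_toFun := e.symm.continuous
      comm := fun y => by
        obtain ⟨x, rfl⟩ := e.surjective y
        rw [e.symm_apply_apply, e.symm_apply_eq, he, he]
        exact (Hom.comm f x).symm }
  exact ⟨g, Hom.ext (funext e.symm_apply_apply), Hom.ext (funext e.apply_symm_apply)⟩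

end MapDS

namespace RWFlowGS

variable {A B : RWFlowGS.{u}}

theorem rateTime_surjective (x : A.sec) (t : ℝ) :
    Function.Surjective (rateTime A.isSection x t) := by
  intro v
  obtain ⟨r, hr⟩ := A.isSection.surjective_cumTime x (v + t * returnTime A.flow A.sec x)
  exact ⟨r - t, by rw [IsGlobalPoincareSection.rateTime_eq, sub_add_cancel, hr,
    add_sub_cancel_right]⟩

/-- A rate-preserving morphism is determined by its restriction to the section. -/
theorem Hom.ext_of_eqOn {f g : Hom A B} (h : ∀ x ∈ A.sec, f.toFun x = g.toFun x) : f = g := by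
  apply Hom.ext
  · funext p
    obtain ⟨x, t, ht, rfl⟩ := A.isSection.exists_eq_flow p
    rw [f.comm, g.comm, f.time_mul_returnTime x.2 ht.1 ht.2, g.time_mul_returnTime x.2 ht.1 ht.2,
      h x x.2]
  · funext p s
    obtain ⟨x, t, ht, rfl⟩ := A.isSection.exists_eq_flow p
    -- Every real number is a rate time, so rate preservation prescribes the whole time change.
    obtain ⟨v, rfl⟩ := rateTime_surjective x t s
    rw [f.ratePreserving x x.2 t v ht.1 ht.2, g.ratePreserving x x.2 t v ht.1 ht.2]
    simp only [h x x.2]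

/-- The inverse of a rate-preserving morphism whose underlying map is a homeomorphism. -/
noncomputable def Hom.inverse (f : Hom A B) (hf : IsHomeomorph f.toFun) : Hom B A where
  toFun := hf.homeomorph.symm
  time y := (f.isHomeomorph_time (hf.homeomorph.symm y)).homeomorph.symm
  continuous_toFun := hf.homeomorph.symm.continuous
  comm y t := by
    rw [Homeomorph.symm_apply_eq]
    change _ = f.toFun _
    rw [f.comm]
    congr 1
    · exact ((f.isHomeomorph_time _).homeomorph.apply_symm_apply t).symm
    · exact (hf.homeomorph.apply_symm_apply y).symm
  isHomeomorph_time y := (f.isHomeomorph_time _).homeomorph.symm.isHomeomorph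
  strictMono_time y a b hab := by
    rw [← (f.strictMono_time (hf.homeomorph.symm y)).lt_iff_lt]
    have e := (f.isHomeomorph_time (hf.homeomorph.symm y)).homeomorph.apply_symm_apply
    exact ((e a).trans_lt hab).trans_eq (e b).symm
  time_zero y := by
    rw [Homeomorph.symm_apply_eq]
    exact (f.time_zero _).symm
  preserves := by
    ext y
    obtain ⟨x, rfl⟩ := hf.homeomorph.surjective y
    rw [Set.mem_preimage, Homeomorph.symm_apply_apply]
    exact (Set.ext_iff.1 f.preserves x).symm
  ratePreserving y hy t s h0 h1 := by
    obtain ⟨x, rfl⟩ := hf.homeomorph.surjective y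
    have hx : x ∈ A.sec := (Set.ext_iff.1 f.preserves x).2 hy
    have e : B.flow (t * returnTime B.flow B.sec ((hf.homeomorph : _ ≃ₜ _) x))
        ((hf.homeomorph : _ ≃ₜ _) x) =
        (hf.homeomorph : _ ≃ₜ _) (A.flow (t * returnTime A.flow A.sec x) x) := by
      change _ = f.toFun _
      rw [f.comm, f.time_mul_returnTime hx h0 h1]
      rfl
    rw [Homeomorph.symm_apply_eq]
    simp only [e, Homeomorph.symm_apply_apply]
    exact (f.ratePreserving x hx t s h0 h1).symm

theorem isIso_of_isHomeomorph (f : A ⟶ B) (hf : IsHomeomorph (Hom.toWeakFlowHom f).toFun) :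
    IsIso f :=
  ⟨Hom.inverse f hf, Hom.ext_of_eqOn fun x _ => hf.homeomorph.symm_apply_apply x,
    Hom.ext_of_eqOn fun x _ => hf.homeomorph.apply_symm_apply x⟩

theorem rateTime_suspension (hS : SuspensionWellDefined.{u}) (M : MapDS.{u})
    (x : (suspensionObj hS M).sec) (t s : ℝ) :
    rateTime (suspensionObj hS M).isSection x t s = s := by
  have h : ∀ y : (suspensionObj hS M).sec,
      returnTime (suspensionObj hS M).flow (suspensionObj hS M).sec y = 1 := fun y =>
    MappingTorus.returnTime_suspensionFlow M.map (hS M).2.1 y.2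
  simp [rateTime, IsGlobalPoincareSection.returnRate_eq, h]

end RWFlowGS

/-! ### Unit, counit and adjunction -/

namespace MappingTorus

variable {X : Type u} [TopologicalSpace X] (f : X ≃ₜ X)

theorem suspend_one_mk_zero (x : X) : suspend f 1 (mk f x 0) = mk f (f x) 0 := by
  rw [← cover_eq_suspend, ← mk_one]
  exact cover_coe f x 1

/-- The embedding `x ↦ [x, 0]` of `X` onto the zero section. -/
def toZeroSection (x : X) : zeroSection f := ⟨mk f x 0, x, rfl⟩

theorem isHomeomorph_toZeroSection : IsHomeomorph (toZeroSection f) := by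
  have h0 : ∀ x, mk f x 0 = cover f (x, 0) := fun x => (cover_coe f x 0).symm
  refine ⟨((continuous_mk f).comp (continuous_id.prodMk continuous_const)).subtype_mk _, ?_, ?_, ?_⟩
  · intro U hU
    -- Openness: only the integer `0` lies in `(-1/2, 1/2)`, so the image is the trace on the
    -- section of the open image of a strip.
    have e : toZeroSection f '' U =
        Subtype.val ⁻¹' (cover f '' (U ×ˢ Set.Ioo (-1 / 2 : ℝ) (1 / 2))) := by
      ext ⟨p, hp⟩
      constructor
      · rintro ⟨x, hx, hxp⟩
        exact ⟨(x, 0), ⟨hx, by norm_num, by norm_num⟩,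
          (h0 x).symm.trans (congrArg Subtype.val hxp)⟩
      · rintro ⟨⟨x, r⟩, ⟨hx, h1, h2⟩, rfl⟩
        obtain ⟨n, rfl⟩ := (cover_mem_zeroSection f x _).1 hp
        have hn : n = 0 := by
          have h3 : (n : ℝ) < 1 := h2.trans (by norm_num)
          have h4 : (-1 : ℝ) < n := lt_trans (by norm_num) h1
          norm_cast at h3 h4
          omega
        subst hn
        exact ⟨x, hx, Subtype.ext ((h0 x).trans (by simp only [Int.cast_zero]))⟩
    rw [e]
    exact (isOpenMap_cover f _ (hU.prod isOpen_Ioo)).preimage continuous_subtype_val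
  · intro x y hxy
    exact (mk_injective f (by simp) (by simp) (congrArg Subtype.val hxy)).1
  · rintro ⟨_, x, rfl⟩
    exact ⟨x, rfl⟩

end MappingTorus

/-- The unit `x ↦ [x, 0]`. -/
noncomputable def suspensionUnit (M : MapDS.{u}) :
    MapDS.Hom M ((poincareFunctor poincareWellDefined).obj
      ((suspensionFunctor suspensionWellDefined).obj M)) where
  toFun := MappingTorus.toZeroSection M.map
  continuous_toFun := (MappingTorus.isHomeomorph_toZeroSection M.map).continuous
  comm x := by
    refine Subtype.ext ?_
    have hT : returnTime (MappingTorus.suspensionFlow M.map (suspensionWellDefined M).2.1)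
        (MappingTorus.zeroSection M.map) (MappingTorus.mk M.map x 0) = 1 :=
      MappingTorus.returnTime_suspensionFlow M.map _ ⟨x, rfl⟩
    change MappingTorus.mk M.map (M.map x) 0 = MappingTorus.suspend M.map
      (returnTime (MappingTorus.suspensionFlow M.map (suspensionWellDefined M).2.1)
        (MappingTorus.zeroSection M.map) (MappingTorus.mk M.map x 0)) (MappingTorus.mk M.map x 0)
    rw [hT, MappingTorus.suspend_one_mk_zero]

/-- The counit `([x, t] ↦ Φ(x, t T_Φ(x)), ([x, t], s) ↦ ∫₀^{s+t} R_Φ(x) - t T_Φ(x))`. -/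
noncomputable def suspensionCounit (A : RWFlowGS.{u}) :
    RWFlowGS.Hom ((suspensionFunctor suspensionWellDefined).obj
      ((poincareFunctor poincareWellDefined).obj A)) A where
  toFun := A.isSection.torusMap
  time := A.isSection.torusTime
  continuous_toFun := A.isSection.isHomeomorph_torusMap.continuous
  comm p s := A.isSection.torusMap_suspend p s
  isHomeomorph_time := A.isSection.isHomeomorph_torusTime
  strictMono_time := A.isSection.strictMono_torusTime
  time_zero p := by
    obtain ⟨⟨x, r⟩, rfl⟩ := MappingTorus.cover_surjective _ p
    exact (A.isSection.torusTime_cover x r 0).trans (by rw [zero_add, sub_self])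
  preserves := Set.ext fun p => (A.isSection.torusMap_mem_iff p).symm
  ratePreserving := by
    intro p hp t s h0 h1
    obtain ⟨(x : A.sec), rfl⟩ := hp
    have hT : t * returnTime (MappingTorus.suspensionFlow A.isSection.poincareHomeomorph
        (suspensionWellDefined ((poincareFunctor poincareWellDefined).obj A)).2.1)
        (MappingTorus.zeroSection A.isSection.poincareHomeomorph)
        (MappingTorus.mk A.isSection.poincareHomeomorph x 0) = t :=
      (congrArg (t * ·) (MappingTorus.returnTime_suspensionFlow A.isSection.poincareHomeomorph _
        ⟨x, rfl⟩)).trans (mul_one t)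
    have hx : ∀ hm, (⟨A.isSection.torusMap (MappingTorus.mk _ x 0), hm⟩ : A.sec) = x := fun _ =>
      Subtype.ext (A.isSection.torusMap_mk_zero x)
    -- The suspension has return time one and the identity as rate time, so the condition reduces to
    -- the value of `torusTime` at `[x, t]`.
    exact (congrArg₂ (fun a b => A.isSection.torusTime
        (MappingTorus.suspend _ a (MappingTorus.mk _ x 0)) b) hT
        (RWFlowGS.rateTime_suspension suspensionWellDefined _ _ t s)).trans
      ((A.isSection.torusTime_suspend_mk_zero x ⟨h0, h1.le⟩ s).trans
        (congrArg (fun y => rateTime A.isSection y t s) (hx _).symm))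

/-- The adjunction between suspension and first return. -/
noncomputable def suspensionAdjunction :
    suspensionFunctor suspensionWellDefined.{u} ⊣ poincareFunctor poincareWellDefined.{u} :=
  Adjunction.mkOfUnitCounit
    { unit :=
        { app := suspensionUnit
          naturality := fun M N f => rfl }
      counit :=
        { app := suspensionCounit
          naturality := fun A B f => RWFlowGS.Hom.ext_of_eqOn <| by
            intro p hp
            obtain ⟨(x : A.sec), rfl⟩ := hp
            change B.isSection.torusMap (MappingTorus.mk B.isSection.poincareHomeomorph
                ⟨(RWFlowGS.Hom.toWeakFlowHom f).toFun x, RWFlowGS.Hom.mapsTo f x.2⟩ 0) =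
              (RWFlowGS.Hom.toWeakFlowHom f).toFun (A.isSection.torusMap (MappingTorus.mk _ x 0))
            rw [IsGlobalPoincareSection.torusMap_mk_zero,
              IsGlobalPoincareSection.torusMap_mk_zero] }
      left_triangle := by
        ext M
        refine RWFlowGS.Hom.ext_of_eqOn ?_
        rintro _ ⟨x, rfl⟩
        exact (suspensionWellDefined M).2.2.torusMap_mk_zero ⟨MappingTorus.mk M.map x 0, x, rfl⟩
      right_triangle := by
        ext A
        refine MapDS.Hom.ext (funext fun x => ?_)
        exact Subtype.ext (A.isSection.torusMap_mk_zero x) }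

instance isIso_suspensionUnit (M : MapDS.{u}) : IsIso (suspensionAdjunction.unit.app M) :=
  MapDS.isIso_of_isHomeomorph _ (MappingTorus.isHomeomorph_toZeroSection M.map)

instance isIso_suspensionCounit (A : RWFlowGS.{u}) : IsIso (suspensionAdjunction.counit.app A) :=
  RWFlowGS.isIso_of_isHomeomorph _ A.isSection.isHomeomorph_torusMap

theorem mainTheorem2 :
    Nonempty (MapDS.{u} ≌ RWFlowGS.{u}) ∧
    ∃ (hS : SuspensionWellDefined.{u}) (hP : PoincareWellDefined.{u})
      (adj : suspensionFunctor hS ⊣ poincareFunctor hP),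
      (∀ (M : MapDS.{u}) (x : M.carrier),
        (MapDS.Hom.toFun (adj.unit.app M) x : MappingTorus.zeroSection M.map) =
          ⟨MappingTorus.mk M.map x 0, x, rfl⟩) ∧
      (∀ (A : RWFlowGS.{u}) (x : A.sec) (t : unitInterval), (t : ℝ) < 1 →
        (RWFlowGS.Hom.toWeakFlowHom (adj.counit.app A)).toFun
            (MappingTorus.mk ((poincareFunctor hP).obj A).map x t) =
          A.flow (t * returnTime A.flow A.sec x) x ∧
        ∀ s : ℝ, (RWFlowGS.Hom.toWeakFlowHom (adj.counit.app A)).time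
            (MappingTorus.mk ((poincareFunctor hP).obj A).map x t) s =
          rateTime A.isSection x t s) ∧
      IsIso adj.unit ∧ IsIso adj.counit := by
  refine ⟨⟨suspensionAdjunction.toEquivalence⟩, suspensionWellDefined, poincareWellDefined,
    suspensionAdjunction, fun M x => rfl, fun A x t _ => ⟨rfl, fun s => rfl⟩,
    NatIso.isIso_of_isIso_app _, NatIso.isIso_of_isIso_app _⟩
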